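/- **Setting.** Let $F:\mathbb{R}^n\times\mathbb{R}^d\to\mathbb{R}$ be measurable and twice differentiable in its first argument $\theta$, let $x$ be a random vector in $\mathbb{R}^d$ with distribution $D$, and let $f(\theta)=\mathbb{E}_x[F(\theta,x)]$ (assumed to exist for every $\theta$). At each iteration $t=1,2,\dots$ a batch $b_t$ of $m_t\ge 1$ samples is drawn, all samples of all batches being independent with distribution $D$, and $f^t(\theta)=\frac1{m_t}\sum_{x\in b_t}F(\theta,x)$. *Base optimizer.* BaseOpt is a first-order optimizer with a diagonal preconditioner: at iteration $t$ it has a diagonal preconditioner $\mathrm{diag}(p_t)$, where $p_t\in\mathbb{R}^n$ is a measurable function of the vectors $g_2$ (below) passed to it in the iterations before $t$; with $q_t=1/p_t$ (entrywise) and step size $\eta_t$ its step on the input $g_2$ is $d_b=-\eta_t\,\mathrm{diag}(q_t)g_2$. *ESE.* For integers $k,\ell\ge 0$ with $k+\ell\le n$ and a symmetric $A\in\mathbb{R}^{n\times n}$, ESE runs $m=\min\{n,\max\{4(k+\ell),\lceil 2\ln n\rceil\}\}$ Lanczos iterations with full orthogonalization on $A$, with any starting vector (and any restart after a breakdown), which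 gives $U\in\mathbb{R}^{n\times m}$ with orthonormal columns and a symmetric tridiagonal $T_A\in\mathbb{R}^{m\times m}$; with an eigendecomposition $T_A=Q\Lambda Q^T$, $\Lambda$ sorted from largest to smallest, it returns the vector $\widehat\lambda$ of the first $k$ and last $\ell$ diagonal entries of $\Lambda$ and the matrix $\widehat V$ of the corresponding columns of $UQ$. The choices made in it depend measurably on $A$. *FOSI.* Fix $\theta_1\in\mathbb{R}^n$, integers $T\ge1$ and $W\ge 1$, and a damping constant $\delta>0$; initially $u=0$, $\widehat V=0$. Iteration $t=1,2,\dots$ is: 1. if $t-1\ge W$ and $T$ divides $t-1-W$, call ESE on $\nabla^2 f^{i}(\theta_t)$ for a predefined index $i=i(t)<t$, and set $u=1/|\widehat\lambda|$ entrywise, where $\delta$ is first added to the entries of $|\widehat\lambda|$ smaller than $\delta$; 2. $g=\nabla f^t(\theta_t)$, $g_1=\widehat V\widehat V^Tg$, $g_2=g-g_1$, $d_1=-\eta_t\widehat V\big((\widehat V^Tg_1)\odot u\big)$, $d_b=-\eta_t\,\mathrm{diag}(q_t)g_2$, $d_2=d_b-\widehat V\widehat V^Td_b$, and $\theta_{t+1}=\theta_t+d_1+d_2$;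 that is, both learning rates of FOSI equal the step size $\eta_t$, and the preconditioner used at iteration $t$ depends only on $b_1,\dots,b_{t-1}$. **Lemma 3.** Let $\beta\in(0.5,1)$ and $c>0$ be constants, let $\eta_t=c\,t^{-\beta}$, and assume: 1. $f$ is $L$-smooth (differentiable with $L$-Lipschitz gradient) and $f\ge f^{\mathrm{low}}$ for a real number $f^{\mathrm{low}}$. 2. For every iteration $t$, almost surely $\mathbb{E}_{x}[\nabla_\theta F(\theta_t,x)]=\nabla f(\theta_t)$ and $\mathbb{E}_{x}[\|\nabla_\theta F(\theta_t,x)-\nabla f(\theta_t)\|^2]\le\sigma^2$, where $\sigma>0$ and the expectation is over $x\sim D$ with $\theta_t$ held fixed. 3. There are constants $z,\rho>0$ such that $\|\nabla^2_\theta F(\theta,x)\|\le z$ (spectral norm) for all $\theta,x$, and, almost surely, at every iteration all diagonal entries of BaseOpt's preconditioner lie in $[\rho,z]$. Then $\mathbb{E}[\|\nabla f(\theta_t)\|^2]<\infty$ for all $t$, and for given $\epsilon\in(0,1)$ the number of iterations $N$ needed to obtain $$\frac1N\sum_{t=1}^N\mathbb{E}\big[\|\nabla f(\theta_t)\|^2\big]\le\epsilon$$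 is $N=O\big(\epsilon^{-1/(1-\beta)}\big)$: there is a constant $C>0$, depending only on $L,\sigma,z,\rho,\delta,c,\beta$ and an upper bound $\Delta$ on $f(\theta_1)-f^{\mathrm{low}}$, such that for every $\epsilon\in(0,1)$ the inequality holds for all integers $N\ge C\,\epsilon^{-1/(1-\beta)}$. -/

import Mathlib

open MeasureTheory ProbabilityTheory
open scoped Gradient NNReal ENNReal

noncomputable section

/-- `ℝⁿ` with the Euclidean norm. -/
abbrev Vec (n : ℕ) : Type := EuclideanSpace ℝ (Fin n)

/-- `V̂ V̂ᵀ g`. -/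
def colProj {n : ℕ} {κ : Type} [Fintype κ] (V : Matrix (Fin n) κ ℝ) (g : Vec n) : Vec n :=
  WithLp.toLp 2 (V.mulVec (V.transpose.mulVec g.ofLp))

/-- The Hessian of `g` at `θ`, as an operator on `ℝⁿ` (its norm is the spectral norm). -/
def hessian {n : ℕ} (g : Vec n → ℝ) (θ : Vec n) : Vec n →L[ℝ] Vec n :=
  fderiv ℝ (gradient g) θ

/-- The Hessian of `g` at `θ`, as a matrix in the standard basis. -/
def hessianMatrix {n : ℕ} (g : Vec n → ℝ) (θ : Vec n) : Matrix (Fin n) (Fin n) ℝ :=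
  fun i j => hessian g θ (EuclideanSpace.single j 1) i

/-- `L`-smoothness: `g` is differentiable and its gradient is `L`-Lipschitz. -/
def LSmooth {n : ℕ} (L : ℝ≥0) (g : Vec n → ℝ) : Prop :=
  Differentiable ℝ g ∧ LipschitzWith L (gradient g)

/-! ### Extreme spectrum estimation (ESE) -/

/-- The number `m = max {4 (k + ℓ), 2 ln n}` of Lanczos iterations (at most `n` orthonormal Lanczos
vectors exist). -/
def lanczosSteps (n k l : ℕ) : ℕ :=
  min n (max (4 * (k + l)) ⌈2 * Real.log n⌉₊)

/-- `U`, `T` is a possible output of `m` Lanczos iterations (in exact arithmetic, with full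
orthogonalization) on the symmetric matrix `A`: `U` has orthonormal columns `u₀, …, u_{m-1}`,
`T` is symmetric tridiagonal, and the three-term recurrence
`A u_j = T_{j-1,j} u_{j-1} + T_{j,j} u_j + T_{j+1,j} u_{j+1}` holds for `j < m - 1`, while for
`j = m - 1` it holds up to a residual orthogonal to all the `u_i`. The starting vector `u₀` is
arbitrary, and so is the vector with which the iteration is restarted after a breakdown
(`T_{j+1,j} = 0`). -/
structure IsLanczosOutput {n m : ℕ} (A : Matrix (Fin n) (Fin n) ℝ)
    (U : Matrix (Fin n) (Fin m) ℝ) (T : Matrix (Fin m) (Fin m) ℝ) : Prop where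
  orthonormal : U.transpose * U = 1
  symm : T.IsSymm
  tridiagonal : ∀ i j : Fin m, (i : ℕ) + 1 < j → T i j = 0
  recurrence : ∀ (a : Fin n) (j : Fin m), (j : ℕ) + 1 < m → (A * U) a j = (U * T) a j
  residual : U.transpose * (A * U - U * T) = 0

/-- `lam`, `V` is a possible output `λ̂`, `V̂` of ESE on the symmetric matrix `A`: with
`U`, `T` from Lanczos and `T = Q Λ Qᵀ` an eigendecomposition, `Λ` sorted from largest to smallest,
`λ̂` consists of the first `k` and the last `ℓ` entries of `Λ`, and `V̂` of the corresponding
columns of `U Q`. -/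
def IsESEOutput {n k l : ℕ} (A : Matrix (Fin n) (Fin n) ℝ)
    (lam : Fin k ⊕ Fin l → ℝ) (V : Matrix (Fin n) (Fin k ⊕ Fin l) ℝ) : Prop :=
  ∃ (U : Matrix (Fin n) (Fin (lanczosSteps n k l)) ℝ)
    (T Q : Matrix (Fin (lanczosSteps n k l)) (Fin (lanczosSteps n k l)) ℝ)
    (Λ : Fin (lanczosSteps n k l) → ℝ),
    IsLanczosOutput A U T ∧
    Q.transpose * Q = 1 ∧ T = Q * Matrix.diagonal Λ * Q.transpose ∧ Antitone Λ ∧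
    (∀ i : Fin k, ∃ r : Fin (lanczosSteps n k l), (r : ℕ) = i ∧
      lam (Sum.inl i) = Λ r ∧ ∀ a, V a (Sum.inl i) = (U * Q) a r) ∧
    (∀ j : Fin l, ∃ r : Fin (lanczosSteps n k l), (r : ℕ) + l = lanczosSteps n k l + j ∧
      lam (Sum.inr j) = Λ r ∧ ∀ a, V a (Sum.inr j) = (U * Q) a r)

/-- An implementation of the ESE procedure: a choice of starting vectors and of
eigendecompositions, depending measurably on the matrix. -/
structure ESE (n k l : ℕ) where
  /-- `λ̂` as a function of the Hessian -/
  eigval : (Fin n → Fin n → ℝ) → (Fin k ⊕ Fin l → ℝ)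
  /-- `V̂` as a function of the Hessian -/
  eigvec : (Fin n → Fin n → ℝ) → (Fin n → Fin k ⊕ Fin l → ℝ)
  measurable_eigval : Measurable eigval
  measurable_eigvec : Measurable eigvec
  isOutput : ∀ A : Matrix (Fin n) (Fin n) ℝ, A.IsSymm →
    IsESEOutput A (eigval A) (Matrix.of (eigvec A))

/-! ### The base optimizer -/

/-- A first-order optimizer with a diagonal preconditioner: the diagonal of the preconditioner at
iteration `t` is a measurable function of the `t` gradients that the optimizer has received in the
iterations `0, …, t - 1`. -/
structure BaseOpt (n : ℕ) where
  /-- the diagonal of the preconditioner -/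
  prec : (t : ℕ) → (Fin t → Vec n) → (Fin n → ℝ)
  measurable_prec : ∀ t, Measurable (prec t)

/-- BaseOptStep: `d_b = -η diag(q) g₂`, where `q` is the entrywise inverse of the diagonal `p` of the
preconditioner. -/
def baseOptStep {n : ℕ} (η : ℝ) (p : Fin n → ℝ) (g₂ : Vec n) : Vec n :=
  WithLp.toLp 2 fun i => -η * ((p i)⁻¹ * g₂ i)

/-! ### FOSI -/

/-- `u = 1 / |λ̂|`, where `δ` is added to the entries of `|λ̂|` that are smaller than `δ`. -/
def invAbs {κ : Type} (δ : ℝ) (lam : κ → ℝ) : κ → ℝ :=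
  fun i => 1 / (if |lam i| < δ then |lam i| + δ else |lam i|)

/-- UpdateStep, with learning rate `α` for the Newton part and `η` for the base optimizer, whose
preconditioner has the diagonal `p`. -/
def updateStep {n : ℕ} {κ : Type} [Fintype κ] (α η : ℝ) (p : Fin n → ℝ)
    (θ g : Vec n) (V : Matrix (Fin n) κ ℝ) (u : κ → ℝ) : Vec n :=
  let g₁ := colProj V g
  let g₂ := g - colProj V g
  let d₁ : Vec n := -(α • WithLp.toLp 2 (V.mulVec fun i => V.transpose.mulVec g₁.ofLp i * u i))
  let db := baseOptStep η p g₂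
  let d₂ := db - colProj V db
  θ + d₁ + d₂

/-- The data that determine a run of FOSI with mini-batches. -/
structure FOSI (n d k l : ℕ) where
  /-- the loss `F(θ, x)` -/
  F : Vec n → Vec d → ℝ
  /-- the base optimizer -/
  baseOpt : BaseOpt n
  /-- the ESE procedure used at iteration `t` -/
  ese : ℕ → ESE n k l
  /-- an ESE call at iteration `t` is made with the batch function `f^i` for `i = eseBatch t` -/
  eseBatch : ℕ → ℕ
  /-- the number of samples in the batch of iteration `t` -/
  batchSize : ℕ → ℕ
  /-- number of iterations between two ESE calls -/
  T : ℕ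
  /-- number of warmup iterations -/
  W : ℕ
  /-- the constant that is added to small entries of `|λ̂|` -/
  damping : ℝ
  /-- the step size of iteration `t` -/
  stepSize : ℕ → ℝ
  /-- the initial point -/
  init : Vec n

/-- The variables of FOSI at the beginning of iteration `t`. -/
structure FOSIState (n k l t : ℕ) where
  /-- the parameter vector `θ_t` -/
  θ : Vec n
  /-- the vector `u` -/
  u : Fin k ⊕ Fin l → ℝ
  /-- the matrix `V̂` -/
  V : Matrix (Fin n) (Fin k ⊕ Fin l) ℝ
  /-- the vectors `g₂` of the iterations `0, …, t - 1` -/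
  hist : Fin t → Vec n

namespace FOSI

variable {n d k l : ℕ}

/-- A sequence of batches `b_0, b_1, …`. -/
abbrev Batches (A : FOSI n d k l) : Type := (t : ℕ) → Fin (A.batchSize t) → Vec d

/-- The batch function `f^t(θ) = (1/m_t) ∑ F(θ, x_i)`. -/
def batchLoss (A : FOSI n d k l) (b : A.Batches) (t : ℕ) (θ : Vec n) : ℝ :=
  (1 / (A.batchSize t : ℝ)) * ∑ i, A.F θ (b t i)

/-- ESE is called at iteration `t`. -/
def IsESETime (A : FOSI n d k l) (t : ℕ) : Prop := A.W ≤ t ∧ (t - A.W) % A.T = 0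

instance (A : FOSI n d k l) (t : ℕ) : Decidable (A.IsESETime t) :=
  inferInstanceAs (Decidable (_ ∧ _))

/-- The possible ESE call at iteration `t`, on the Hessian of `f^i` at `θ_t`. -/
def runESE (A : FOSI n d k l) (b : A.Batches) (t : ℕ) (s : FOSIState n k l t) :
    FOSIState n k l t :=
  if A.IsESETime t then
    let H := hessianMatrix (A.batchLoss b (A.eseBatch t)) s.θ
    { s with
      u := invAbs A.damping ((A.ese t).eigval H)
      V := Matrix.of ((A.ese t).eigvec H) }
  else s

/-- One iteration of FOSI: the possible ESE call, the stochastic gradient `g = ∇f^t(θ_t)`, and the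
update step, in which the base optimizer uses the preconditioner computed from the vectors `g₂` of
the earlier iterations; then the current `g₂` is passed to the base optimizer. -/
def step (A : FOSI n d k l) (b : A.Batches) (t : ℕ) (s : FOSIState n k l t) :
    FOSIState n k l (t + 1) :=
  let s' := A.runESE b t s
  let g := gradient (A.batchLoss b t) s'.θ
  { θ := updateStep (A.stepSize t) (A.stepSize t) (A.baseOpt.prec t s'.hist) s'.θ g s'.V s'.u
    u := s'.u
    V := s'.V
    hist := Fin.snoc s'.hist (g - colProj s'.V g) }

/-- The state at the beginning of iteration `t` of the run on the batches `b`. -/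
def state (A : FOSI n d k l) (b : A.Batches) : (t : ℕ) → FOSIState n k l t
  | 0 => { θ := A.init, u := 0, V := 0, hist := Fin.elim0 }
  | t + 1 => A.step b t (A.state b t)

/-- The iterate `θ_t`. -/
def iterate (A : FOSI n d k l) (b : A.Batches) (t : ℕ) : Vec n := (A.state b t).θ

/-- The diagonal of the base optimizer's preconditioner at iteration `t`. -/
def precDiag (A : FOSI n d k l) (b : A.Batches) (t : ℕ) : Fin n → ℝ :=
  A.baseOpt.prec t (A.state b t).hist

/-- The objective `f(θ) = E_x [F(θ, x)]`, where `x` has the distribution `D`. -/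
def objective (A : FOSI n d k l) (D : Measure (Vec d)) (θ : Vec n) : ℝ := ∫ x, A.F θ x ∂D

end FOSI

end

/-!
When both learning rates agree, a step of FOSI is a step of stochastic gradient descent
preconditioned by the operator `P = V̂ diag(u) V̂ᵀ + (1 - V̂ V̂ᵀ) diag(p)⁻¹ (1 - V̂ V̂ᵀ)`. The
entries of `λ̂` are Rayleigh quotients of a batch Hessian, so `|λ̂| ≤ z`, and damping keeps them
away from `0`; hence the spectrum of `P` lies in an interval `[a, K]` with `0 < a`. Moreover `P` is
determined by the earlier batches, given which the noise of the current gradient is centred.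

Writing `D_t` for the expected gap `f(θ_t) - f_low` and `G_t` for `E ‖∇f(θ_t)‖²`, the descent lemma
and `‖∇f‖² ≤ 2 L (f - f_low)` give
`D_{t+1} + a η_t G_t ≤ (1 + 2 (L K)² η_t²) D_t + L K² σ² η_t²`. Since `β > 1/2`, `∑ η_t²` converges,
and the discrete Grönwall inequality bounds `∑ η_t G_t` uniformly. The step sizes of the first `N`
iterations are at least `c N ^ (-β)`, so the average of `G_t` is `O(N ^ (β - 1))`.
-/

lemma add_sum_le_of_dissipative_recursion {D γ α b : ℕ → ℝ} (hD : 0 ≤ D 0) (hγ : ∀ t, 0 ≤ γ t)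
    (hα : ∀ t, 0 ≤ α t) (hb : ∀ t, 0 ≤ b t)
    (hrec : ∀ t, D (t + 1) + γ t ≤ (1 + α t) * D t + b t) (N : ℕ) :
    D N + ∑ t ∈ Finset.range N, γ t ≤
      (D 0 + ∑ t ∈ Finset.range N, b t) * Real.exp (∑ t ∈ Finset.range N, α t) := by
  have hsum : ∀ t, 0 ≤ ∑ s ∈ Finset.range t, γ s := fun t => Finset.sum_nonneg fun s _ => hγ s
  have hgronwall := discrete_gronwall (n₀ := 0) (b := b) (c := α)
    (u := fun t => D t + ∑ s ∈ Finset.range t, γ s) (by simpa using hD)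
    (fun t _ => by
      rw [Finset.sum_range_succ]
      linarith [hrec t, mul_nonneg (hα t) (hsum t)])
    (fun t _ => hα t) (fun t _ => hb t) N.zero_le
  simpa using hgronwall

lemma summable_sq_mul_rpow_neg (c : ℝ) {β : ℝ} (hβ : 1 / 2 < β) :
    Summable fun t : ℕ => (c * ((t : ℝ) + 1) ^ (-β)) ^ 2 := by
  have h : Summable fun t : ℕ => c ^ 2 * ((t + 1 : ℕ) : ℝ) ^ (-(2 * β)) :=
    ((summable_nat_add_iff 1).2 (Real.summable_nat_rpow.2 (by linarith))).mul_left _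
  refine h.congr fun t => ?_
  rw [mul_pow, ← Real.rpow_mul_natCast (by positivity)]
  push_cast
  ring_nf

lemma average_le_of_sum_rpow_neg_mul_le {c β M : ℝ} {G : ℕ → ℝ} {N : ℕ} (hc : 0 < c) (hβ : 0 ≤ β)
    (hG : ∀ t, 0 ≤ G t) (hN : 0 < N)
    (hM : ∑ t ∈ Finset.range N, c * ((t : ℝ) + 1) ^ (-β) * G t ≤ M) :
    1 / (N : ℝ) * ∑ t ∈ Finset.range N, G t ≤ M / c * (N : ℝ) ^ (β - 1) := by
  have hN' : (0 : ℝ) < N := by exact_mod_cast hN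
  have hlast : c * (N : ℝ) ^ (-β) * ∑ t ∈ Finset.range N, G t ≤ M := by
    refine le_trans ?_ hM
    rw [Finset.mul_sum]
    refine Finset.sum_le_sum fun t ht => ?_
    have ht' : (t : ℝ) + 1 ≤ N := by exact_mod_cast Finset.mem_range.1 ht
    have hpow := Real.rpow_le_rpow_of_nonpos (by positivity) ht' (neg_nonpos.2 hβ)
    have := hG t
    gcongr
  have hinv : (N : ℝ) ^ (β - 1) * (N : ℝ) ^ (-β) = 1 / N := by
    rw [← Real.rpow_add hN', one_div, ← Real.rpow_neg_one]
    ring_nf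
  calc 1 / (N : ℝ) * ∑ t ∈ Finset.range N, G t
      = (N : ℝ) ^ (β - 1) / c * (c * (N : ℝ) ^ (-β) * ∑ t ∈ Finset.range N, G t) := by
        rw [← hinv]; field_simp
    _ ≤ (N : ℝ) ^ (β - 1) / c * M := by gcongr
    _ = M / c * (N : ℝ) ^ (β - 1) := by ring

lemma mul_rpow_sub_one_le {S ε β x : ℝ} (hS : 0 < S) (hε : 0 < ε) (hβ : β < 1)
    (hx : S ^ (1 / (1 - β)) * ε ^ (-(1 / (1 - β))) ≤ x) : S * x ^ (β - 1) ≤ ε := by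
  have hx0 : 0 < x := lt_of_lt_of_le (by positivity) hx
  have hquot : S / ε ≤ x ^ (1 - β) := by
    rw [Real.rpow_neg hε.le, ← div_eq_mul_inv, ← Real.div_rpow hS.le hε.le, one_div] at hx
    exact (Real.rpow_inv_le_iff_of_pos (by positivity) hx0.le (by linarith)).1 hx
  rw [← neg_sub, Real.rpow_neg hx0.le, ← div_eq_mul_inv, div_le_iff₀ (by positivity)]
  rwa [div_le_iff₀' hε] at hquot

lemma exists_forall_average_le {a c β K B : ℝ} (ha : 0 < a) (hc : 0 < c)
    (hβ : β ∈ Set.Ioo (1 / 2 : ℝ) 1) (hK : 0 ≤ K) (hB : 0 ≤ B) (Δ : ℝ) :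
    ∃ C : ℝ, 0 < C ∧ ∀ η D G : ℕ → ℝ, (∀ t, η t = c * ((t : ℝ) + 1) ^ (-β)) →
      (∀ t, 0 ≤ D t) → (∀ t, 0 ≤ G t) → D 0 ≤ Δ →
      (∀ t, D (t + 1) + a * η t * G t ≤ (1 + K * η t ^ 2) * D t + B * η t ^ 2) →
      ∀ ε : ℝ, 0 < ε → ∀ N : ℕ, C * ε ^ (-(1 / (1 - β))) ≤ N →
        1 / (N : ℝ) * ∑ t ∈ Finset.range N, G t ≤ ε := by
  obtain ⟨hβ_half, hβ_one⟩ := hβ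
  have hsummable := summable_sq_mul_rpow_neg c hβ_half
  set S : ℝ := ∑' t : ℕ, (c * ((t : ℝ) + 1) ^ (-β)) ^ 2
  have : 0 ≤ S := tsum_nonneg fun _ => sq_nonneg _
  set M : ℝ := (|Δ| + 1 + B * S) * Real.exp (K * S)
  refine ⟨(M / (a * c)) ^ (1 / (1 - β)), by positivity, ?_⟩
  intro η D G hη hD hG hΔ hrec ε hε N hN
  have hsum_sq : ∑ t ∈ Finset.range N, η t ^ 2 ≤ S := by
    simp only [hη]
    exact hsummable.sum_le_tsum _ fun _ _ => sq_nonneg _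
  have hdissipated : ∑ t ∈ Finset.range N, a * η t * G t ≤ M := by
    have hη_nonneg : ∀ t, 0 ≤ η t := fun t => by rw [hη]; positivity
    have hgronwall := add_sum_le_of_dissipative_recursion (hD 0)
      (fun t => mul_nonneg (mul_nonneg ha.le (hη_nonneg t)) (hG t))
      (fun t => mul_nonneg hK (sq_nonneg _)) (fun t => mul_nonneg hB (sq_nonneg _)) hrec N
    simp only [← Finset.mul_sum (Finset.range N) (fun t => η t ^ 2)] at hgronwall
    have hΔ' : D 0 ≤ |Δ| + 1 := by linarith [le_abs_self Δ]
    calc ∑ t ∈ Finset.range N, a * η t * G t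
        ≤ (D 0 + B * ∑ t ∈ Finset.range N, η t ^ 2)
            * Real.exp (K * ∑ t ∈ Finset.range N, η t ^ 2) :=
          (le_add_of_nonneg_left (hD N)).trans hgronwall
      _ ≤ M := by dsimp only [M]; gcongr
  have hN_pos : 0 < N := by
    have : (0 : ℝ) < N := lt_of_lt_of_le (by positivity) hN
    exact_mod_cast this
  simp only [hη, ← mul_assoc] at hdissipated
  refine (average_le_of_sum_rpow_neg_mul_le (by positivity) (by linarith) hG hN_pos
    hdissipated).trans ?_
  exact mul_rpow_sub_one_le (by positivity) hε hβ_one hN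

section PreconditionedDescent

variable {E : Type*} [NormedAddCommGroup E] [InnerProductSpace ℝ E]

/-- The operators allowed as preconditioners: symmetric, with quadratic form bounded below by `a`
and operator norm at most `K`. -/
structure IsPreconditioner (a K : ℝ) (P : E →L[ℝ] E) : Prop where
  isSymmetric : (P : E →ₗ[ℝ] E).IsSymmetric
  le_inner : ∀ v, a * ‖v‖ ^ 2 ≤ inner ℝ v (P v)
  norm_le : ‖P‖ ≤ K

lemma IsPreconditioner.norm_apply_add_sq_le {a K : ℝ} {P : E →L[ℝ] E}
    (hP : IsPreconditioner a K P) (v w : E) :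
    ‖P (v + w)‖ ^ 2 ≤ 2 * K ^ 2 * (‖v‖ ^ 2 + ‖w‖ ^ 2) := by
  have hK : 0 ≤ K := (norm_nonneg P).trans hP.norm_le
  calc ‖P (v + w)‖ ^ 2 ≤ (K * (‖v‖ + ‖w‖)) ^ 2 := by
        gcongr
        exact (P.le_of_opNorm_le hP.norm_le _).trans (by gcongr; exact norm_add_le v w)
    _ = K ^ 2 * (‖v‖ + ‖w‖) ^ 2 := by ring
    _ ≤ K ^ 2 * (2 * (‖v‖ ^ 2 + ‖w‖ ^ 2)) := by gcongr; exact add_sq_le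
    _ = _ := by ring

variable [CompleteSpace E] {f : E → ℝ} {L : ℝ≥0}

lemma le_quadratic_of_lipschitzWith_gradient (hf : Differentiable ℝ f)
    (hL : LipschitzWith L (∇ f)) (x v : E) :
    f (x + v) ≤ f x + inner ℝ (∇ f x) v + L / 2 * ‖v‖ ^ 2 := by
  let φ : ℝ → ℝ := fun s => f (x + s • v) - s * inner ℝ (∇ f x) v - L / 2 * ‖v‖ ^ 2 * s ^ 2
  have hφ : ∀ s, HasDerivAt φ
      (inner ℝ (∇ f (x + s • v)) v - inner ℝ (∇ f x) v - L * ‖v‖ ^ 2 * s) s := fun s => by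
    have hline : HasDerivAt (fun s : ℝ => x + s • v) v s := by
      simpa using ((hasDerivAt_id s).smul_const v).const_add x
    have hcomp := ((hf (x + s • v)).hasFDerivAt.comp_hasDerivAt s hline)
    rw [← inner_gradient_left] at hcomp
    refine ((hcomp.sub ((hasDerivAt_id s).mul_const _)).sub
      ((hasDerivAt_pow 2 s).const_mul (L / 2 * ‖v‖ ^ 2))).congr_deriv ?_
    norm_num
    ring
  have hφ_nonpos : ∀ s ∈ interior (Set.Icc (0 : ℝ) 1), deriv φ s ≤ 0 := fun s hs => by
    have hs0 : 0 ≤ s := (interior_subset hs).1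
    have hlip : ‖∇ f (x + s • v) - ∇ f x‖ ≤ L * (s * ‖v‖) := by
      simpa [norm_smul, abs_of_nonneg hs0] using hL.norm_sub_le (x + s • v) x
    rw [(hφ s).deriv, ← inner_sub_left, sub_nonpos]
    calc inner ℝ (∇ f (x + s • v) - ∇ f x) v
        ≤ ‖∇ f (x + s • v) - ∇ f x‖ * ‖v‖ := real_inner_le_norm _ _
      _ ≤ L * (s * ‖v‖) * ‖v‖ := by gcongr
      _ = L * ‖v‖ ^ 2 * s := by ring
  have hφ_anti : AntitoneOn φ (Set.Icc 0 1) :=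
    antitoneOn_of_deriv_nonpos (convex_Icc 0 1)
      (fun s _ => (hφ s).continuousAt.continuousWithinAt)
      (fun s _ => (hφ s).differentiableAt.differentiableWithinAt) hφ_nonpos
  have h01 := hφ_anti (Set.left_mem_Icc.2 zero_le_one) (Set.right_mem_Icc.2 zero_le_one)
    zero_le_one
  norm_num [φ, -inner_gradient_left] at h01
  linarith

lemma norm_gradient_sq_le_of_lipschitzWith_gradient (hf : Differentiable ℝ f)
    (hL : LipschitzWith L (∇ f)) {m : ℝ} (hm : ∀ x, m ≤ f x) (x : E) :
    ‖∇ f x‖ ^ 2 ≤ 2 * L * (f x - m) := by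
  have hgap : 0 ≤ f x - m := sub_nonneg.2 (hm x)
  -- The quadratic upper bound along `x - s ∇f(x)` stays above `m` for every `s`.
  have hquad : ∀ s : ℝ,
      0 ≤ L / 2 * ‖∇ f x‖ ^ 2 * (s * s) + -‖∇ f x‖ ^ 2 * s + (f x - m) := fun s => by
    have hs := (hm _).trans (le_quadratic_of_lipschitzWith_gradient hf hL x (-s • ∇ f x))
    rw [inner_smul_right, real_inner_self_eq_norm_sq, norm_smul, mul_pow, norm_neg,
      Real.norm_eq_abs, sq_abs] at hs
    linarith
  have hdiscrim := discrim_le_zero hquad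
  rw [discrim] at hdiscrim
  rcases (sq_nonneg ‖∇ f x‖).eq_or_lt' with hzero | hpos
  · rw [hzero]; positivity
  · refine le_of_mul_le_mul_left ?_ hpos
    linarith

lemma IsPreconditioner.descent {a K η m : ℝ} {P : E →L[ℝ] E} (hP : IsPreconditioner a K P)
    (hf : Differentiable ℝ f) (hL : LipschitzWith L (∇ f)) (hm : ∀ x, m ≤ f x) (hη : 0 ≤ η)
    (x ξ : E) :
    f (x - η • P (∇ f x + ξ)) - m + a * η * ‖∇ f x‖ ^ 2 ≤
      (1 + 2 * (L * K) ^ 2 * η ^ 2) * (f x - m) - η * inner ℝ (P (∇ f x)) ξ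
        + L * K ^ 2 * η ^ 2 * ‖ξ‖ ^ 2 := by
  have hstep := le_quadratic_of_lipschitzWith_gradient hf hL x (-(η • P (∇ f x + ξ)))
  rw [← sub_eq_add_neg, inner_neg_right, inner_smul_right, map_add, inner_add_right, norm_neg,
    norm_smul, mul_pow, Real.norm_eq_abs, sq_abs, ← map_add] at hstep
  have hsymm : inner ℝ (∇ f x) (P ξ) = inner ℝ (P (∇ f x)) ξ := (hP.isSymmetric _ _).symm
  have hcoercive := mul_le_mul_of_nonneg_left (hP.le_inner (∇ f x)) hη
  have hnorm := mul_le_mul_of_nonneg_left (hP.norm_apply_add_sq_le (∇ f x) ξ)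
    (show 0 ≤ L / 2 * η ^ 2 by positivity)
  have hgrad := mul_le_mul_of_nonneg_left
    (norm_gradient_sq_le_of_lipschitzWith_gradient hf hL hm x)
    (show 0 ≤ L * K ^ 2 * η ^ 2 by positivity)
  rw [hsymm] at hstep
  linarith

end PreconditionedDescent

section StochasticDescent

variable {E Ω : Type*} [NormedAddCommGroup E] [InnerProductSpace ℝ E]
  {m mΩ : MeasurableSpace Ω} {μ : Measure Ω}

lemma integrable_inner_of_memLp_two {v w : Ω → E} (hv : MemLp v 2 μ) (hw : MemLp w 2 μ) :
    Integrable (fun ω => inner ℝ (v ω) (w ω)) μ :=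
  memLp_one_iff_integrable.1 ((innerSL ℝ).memLp_of_bilin 1 hv hw)

variable [CompleteSpace E]

lemma integral_inner_eq_zero_of_condExp_eq_zero [IsFiniteMeasure μ] {v w : Ω → E} (hm : m ≤ mΩ)
    (hv_meas : StronglyMeasurable[m] v) (hv : MemLp v 2 μ) (hw : MemLp w 2 μ)
    (hw_zero : μ[w | m] =ᵐ[μ] 0) : ∫ ω, inner ℝ (v ω) (w ω) ∂μ = 0 := by
  have hpull := condExp_bilin_of_stronglyMeasurable_left (innerSL ℝ) hv_meas
    (integrable_inner_of_memLp_two hv hw) (hw.integrable one_le_two)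
  calc ∫ ω, inner ℝ (v ω) (w ω) ∂μ = ∫ ω, (μ[fun ω => inner ℝ (v ω) (w ω) | m]) ω ∂μ :=
        (integral_condExp hm).symm
    _ = ∫ _, (0 : ℝ) ∂μ := integral_congr_ae <| by
        filter_upwards [hpull, hw_zero] with ω hω hω_zero
        exact hω.trans (by simp [hω_zero])
    _ = 0 := integral_zero _ _

/-- The assumption on stochastic gradient noise: it is centred given the past, represented by the
σ-algebra `m`, and its second moment is at most `σ²`. -/
structure IsCenteredNoise (m : MeasurableSpace Ω) {mΩ : MeasurableSpace Ω} (μ : Measure Ω) (σ : ℝ)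
    (ξ : Ω → E) : Prop where
  memLp : MemLp ξ 2 μ
  condExp_eq_zero : μ[ξ | m] =ᵐ[μ] 0
  integral_norm_sq_le : ∫ ω, ‖ξ ω‖ ^ 2 ∂μ ≤ σ ^ 2

/-- Preconditioned stochastic gradient descent `x_{t+1} = x_t - η_t P_t (∇f(x_t) + ξ_t)`, where
`x_t` and `P_t` are determined by the history `ℱ t`. Of the adaptedness of `P_t`, only that of the
direction `P_t ∇f(x_t)` is recorded. -/
structure IsPreconditionedSGD (f : E → ℝ) (a K σ : ℝ) (η : ℕ → ℝ) (ℱ : Filtration ℕ mΩ)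
    (μ : Measure Ω) (x : ℕ → Ω → E) (P : ℕ → Ω → E →L[ℝ] E) (ξ : ℕ → Ω → E) : Prop where
  stronglyMeasurable_iterate : ∀ t, StronglyMeasurable[ℱ t] (x t)
  stronglyMeasurable_direction : ∀ t, StronglyMeasurable[ℱ t] fun ω => P t ω (∇ f (x t ω))
  isPreconditioner : ∀ t, ∀ᵐ ω ∂μ, IsPreconditioner a K (P t ω)
  isCenteredNoise : ∀ t, IsCenteredNoise (ℱ t) μ σ (ξ t)
  integrable_init : Integrable (fun ω => f (x 0 ω)) μ
  iterate_succ : ∀ t ω, x (t + 1) ω = x t ω - η t • P t ω (∇ f (x t ω) + ξ t ω)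

namespace IsPreconditionedSGD

variable {f : E → ℝ} {L : ℝ≥0} {a K σ low : ℝ} {η : ℕ → ℝ} {ℱ : Filtration ℕ mΩ}
  {x : ℕ → Ω → E} {P : ℕ → Ω → E →L[ℝ] E} {ξ : ℕ → Ω → E} {t : ℕ}
  (h : IsPreconditionedSGD f a K σ η ℱ μ x P ξ) (hf : Differentiable ℝ f)
  (hL : LipschitzWith L (∇ f)) (hlow : ∀ x, low ≤ f x)

include h hf hL hlow

lemma ae_descent (hη : 0 ≤ η t) :
    ∀ᵐ ω ∂μ, f (x (t + 1) ω) - low + a * η t * ‖∇ f (x t ω)‖ ^ 2 ≤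
      (1 + 2 * (L * K) ^ 2 * η t ^ 2) * (f (x t ω) - low)
        - η t * inner ℝ (P t ω (∇ f (x t ω))) (ξ t ω) + L * K ^ 2 * η t ^ 2 * ‖ξ t ω‖ ^ 2 := by
  filter_upwards [h.isPreconditioner t] with ω hω
  rw [h.iterate_succ]
  exact hω.descent hf hL hlow hη _ _

variable [IsProbabilityMeasure μ]

lemma memLp_gradient (hint : Integrable (fun ω => f (x t ω)) μ) :
    MemLp (fun ω => ∇ f (x t ω)) 2 μ := by
  have hmeas := (hL.continuous.comp_stronglyMeasurable (h.stronglyMeasurable_iterate t)).mono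
    (ℱ.le t)
  refine (memLp_two_iff_integrable_sq_norm hmeas.aestronglyMeasurable).2 ?_
  refine ((hint.sub (integrable_const low)).const_mul (2 * L)).mono'
    (hmeas.norm.pow 2).aestronglyMeasurable (.of_forall fun ω => ?_)
  rw [Real.norm_of_nonneg (sq_nonneg _)]
  exact norm_gradient_sq_le_of_lipschitzWith_gradient hf hL hlow _

lemma memLp_direction (hint : Integrable (fun ω => f (x t ω)) μ) :
    MemLp (fun ω => P t ω (∇ f (x t ω))) 2 μ := by
  refine (h.memLp_gradient hf hL hlow hint).of_le_mul (c := K)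
    ((h.stronglyMeasurable_direction t).mono (ℱ.le t)).aestronglyMeasurable ?_
  filter_upwards [h.isPreconditioner t] with ω hω
  exact (P t ω).le_of_opNorm_le hω.norm_le _

lemma integrable_iterate (hη : ∀ t, 0 ≤ η t) (t : ℕ) : Integrable (fun ω => f (x t ω)) μ := by
  induction t with
  | zero => exact h.integrable_init
  | succ t hint =>
    have hgrad := (h.memLp_gradient hf hL hlow hint).integrable_norm_pow two_ne_zero
    have hcross := integrable_inner_of_memLp_two (h.memLp_direction hf hL hlow hint)
      (h.isCenteredNoise t).memLp
    have hnoise := (h.isCenteredNoise t).memLp.integrable_norm_pow two_ne_zero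
    have hmeas := hf.continuous.comp_stronglyMeasurable
      ((h.stronglyMeasurable_iterate (t + 1)).mono (ℱ.le _))
    refine integrable_of_le_of_le hmeas.aestronglyMeasurable (.of_forall fun ω => hlow _) ?_
      (integrable_const low)
      (((((hint.sub (integrable_const low)).const_mul (1 + 2 * (L * K) ^ 2 * η t ^ 2)).sub
        (hcross.const_mul (η t))).add (hnoise.const_mul (L * K ^ 2 * η t ^ 2))).add
        ((integrable_const low).sub (hgrad.const_mul (a * η t))))
    filter_upwards [h.ae_descent hf hL hlow (hη t)] with ω hω
    simp only [Pi.add_apply, Pi.sub_apply]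
    linarith

lemma memLp_gradient_iterate (hη : ∀ t, 0 ≤ η t) (t : ℕ) :
    MemLp (fun ω => ∇ f (x t ω)) 2 μ :=
  h.memLp_gradient hf hL hlow (h.integrable_iterate hf hL hlow hη t)

lemma integral_descent (hη : ∀ t, 0 ≤ η t) (t : ℕ) :
    (∫ ω, f (x (t + 1) ω) - low ∂μ) + a * η t * ∫ ω, ‖∇ f (x t ω)‖ ^ 2 ∂μ ≤
      (1 + 2 * (L * K) ^ 2 * η t ^ 2) * (∫ ω, f (x t ω) - low ∂μ)
        + L * K ^ 2 * σ ^ 2 * η t ^ 2 := by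
  have hint := h.integrable_iterate hf hL hlow hη
  have hgap : ∀ t, Integrable (fun ω => f (x t ω) - low) μ := fun t =>
    (hint t).sub (integrable_const low)
  have hgrad := (h.memLp_gradient_iterate hf hL hlow hη t).integrable_norm_pow two_ne_zero
  have hdir := h.memLp_direction hf hL hlow (hint t)
  have hcross := integrable_inner_of_memLp_two hdir (h.isCenteredNoise t).memLp
  have hnoise := (h.isCenteredNoise t).memLp.integrable_norm_pow two_ne_zero
  have hcross_zero := integral_inner_eq_zero_of_condExp_eq_zero (ℱ.le t)
    (h.stronglyMeasurable_direction t) hdir (h.isCenteredNoise t).memLp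
    (h.isCenteredNoise t).condExp_eq_zero
  have hmain := integral_mono_ae ((hgap (t + 1)).add (hgrad.const_mul (a * η t)))
    ((((hgap t).const_mul (1 + 2 * (L * K) ^ 2 * η t ^ 2)).sub (hcross.const_mul (η t))).add
      (hnoise.const_mul (L * K ^ 2 * η t ^ 2))) (h.ae_descent hf hL hlow (hη t))
  rw [integral_add' (hgap (t + 1)) (hgrad.const_mul _),
    integral_add' (((hgap t).const_mul _).sub (hcross.const_mul _)) (hnoise.const_mul _),
    integral_sub' ((hgap t).const_mul _) (hcross.const_mul _), integral_const_mul,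
    integral_const_mul, integral_const_mul, integral_const_mul, hcross_zero] at hmain
  have hvar := mul_le_mul_of_nonneg_left (h.isCenteredNoise t).integral_norm_sq_le
    (show 0 ≤ L * K ^ 2 * η t ^ 2 by positivity)
  linarith

end IsPreconditionedSGD

end StochasticDescent

section FOSIPreconditioner

open Matrix

open scoped Matrix.Norms.L2Operator in
lemma l2_opNorm_transpose_mul_diagonal_mul_le {ι ν : Type*} [Fintype ι] [DecidableEq ι] [Fintype ν]
    [DecidableEq ν] {J : Matrix ι ν ℝ} (hJ : Jᵀ * J = 1) (w : ι → ℝ) :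
    ‖Jᵀ * diagonal w * J‖ ≤ ‖w‖ := by
  have hJ_norm : ‖Jᵀ‖ * ‖J‖ ≤ 1 := by
    rw [← conjTranspose_eq_transpose_of_trivial] at hJ ⊢
    rw [l2_opNorm_conjTranspose, ← l2_opNorm_conjTranspose_mul_self, hJ,
      ← l2_opNorm_toEuclideanCLM, map_one]
    exact ContinuousLinearMap.norm_id_le
  calc ‖Jᵀ * diagonal w * J‖ ≤ ‖Jᵀ‖ * ‖diagonal w‖ * ‖J‖ :=
        (l2_opNorm_mul _ _).trans (by gcongr; exact l2_opNorm_mul _ _)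
    _ = (‖Jᵀ‖ * ‖J‖) * ‖w‖ := by rw [l2_opNorm_diagonal]; ring
    _ ≤ ‖w‖ := mul_le_of_le_one_left (norm_nonneg w) hJ_norm

lemma isPreconditioner_toEuclideanCLM {ι ν : Type*} [Fintype ι] [DecidableEq ι] [Fintype ν]
    [DecidableEq ν] {J : Matrix ι ν ℝ} (hJ : Jᵀ * J = 1) {w : ι → ℝ} {a K : ℝ} (ha : 0 ≤ a)
    (hK : 0 ≤ K) (hw : ∀ i, w i ∈ Set.Icc a K) :
    IsPreconditioner a K (toEuclideanCLM (𝕜 := ℝ) (Jᵀ * diagonal w * J)) where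
  isSymmetric := by
    have hsymm : (Jᵀ * diagonal w * J).IsHermitian := by
      simpa [conjTranspose_eq_transpose_of_trivial] using
        isHermitian_conjTranspose_mul_mul J (isHermitian_diagonal w)
    exact isSymmetric_toEuclideanLin_iff.2 hsymm
  le_inner v := by
    have inner_eq_sum : ∀ r : ι → ℝ,
        inner ℝ v (toEuclideanCLM (𝕜 := ℝ) (Jᵀ * diagonal r * J) v) =
          ∑ i, r i * (J *ᵥ v.ofLp) i ^ 2 := fun r => by
      rw [inner_toEuclideanCLM, ← mulVec_mulVec, ← mulVec_mulVec, dotProduct_mulVec,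
        vecMul_transpose]
      exact Finset.sum_congr rfl fun i _ => by rw [mulVec_diagonal]; ring
    have norm_sq_eq_sum : ‖v‖ ^ 2 = ∑ i, (J *ᵥ v.ofLp) i ^ 2 := by
      simpa [hJ] using inner_eq_sum 1
    rw [norm_sq_eq_sum, inner_eq_sum, Finset.mul_sum]
    exact Finset.sum_le_sum fun i _ => by gcongr; exact (hw i).1
  norm_le := by
    have hw_norm : ‖w‖ ≤ K := (pi_norm_le_iff_of_nonneg hK).2 fun i => by
      rw [Real.norm_of_nonneg (ha.trans (hw i).1)]
      exact (hw i).2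
    exact (l2_opNorm_transpose_mul_diagonal_mul_le hJ w).trans hw_norm

variable {n : ℕ} {κ : Type} [Fintype κ]

lemma colProj_eq_toEuclideanCLM (V : Matrix (Fin n) κ ℝ) (g : Vec n) :
    colProj V g = toEuclideanCLM (𝕜 := ℝ) (V * Vᵀ) g := by
  ext i
  simp [colProj, mulVec_mulVec]

lemma baseOptStep_eq_toEuclideanCLM (η : ℝ) (p : Fin n → ℝ) (g : Vec n) :
    baseOptStep η p g = -(η • toEuclideanCLM (𝕜 := ℝ) (diagonal p⁻¹) g) := by
  ext i
  simp [baseOptStep, mulVec_diagonal]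

variable [DecidableEq κ]

/-- The operator `V̂ diag(u) V̂ᵀ + (1 - V̂ V̂ᵀ) diag(p)⁻¹ (1 - V̂ V̂ᵀ)` by which FOSI preconditions
the stochastic gradient when both of its learning rates agree. -/
noncomputable def fosiPreconditioner (p : Fin n → ℝ) (V : Matrix (Fin n) κ ℝ) (u : κ → ℝ) :
    Vec n →L[ℝ] Vec n :=
  toEuclideanCLM (𝕜 := ℝ) (V * diagonal u * Vᵀ + (1 - V * Vᵀ) * diagonal p⁻¹ * (1 - V * Vᵀ))

lemma updateStep_eq_sub_smul_fosiPreconditioner {V : Matrix (Fin n) κ ℝ} (hV : Vᵀ * V * Vᵀ = Vᵀ)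
    (η : ℝ) (p : Fin n → ℝ) (θ g : Vec n) (u : κ → ℝ) :
    updateStep η η p θ g V u = θ - η • fosiPreconditioner p V u g := by
  have newton : WithLp.toLp 2 (V *ᵥ fun i => (Vᵀ *ᵥ (colProj V g).ofLp) i * u i) =
      toEuclideanCLM (𝕜 := ℝ) (V * diagonal u * Vᵀ) g := by
    have : (fun i => (Vᵀ *ᵥ (colProj V g).ofLp) i * u i) = diagonal u *ᵥ Vᵀ *ᵥ g.ofLp := by
      ext i
      rw [mulVec_diagonal, colProj, mulVec_mulVec, mulVec_mulVec, hV, mul_comm]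
    ext i
    rw [this, mulVec_mulVec, mulVec_mulVec, ofLp_toEuclideanCLM]
  simp only [updateStep, newton]
  simp only [baseOptStep_eq_toEuclideanCLM, colProj_eq_toEuclideanCLM,
    fosiPreconditioner, map_add, map_mul, map_sub, map_one, map_neg, map_smul,
    _root_.add_apply, _root_.sub_apply, mul_apply_eq_comp, one_apply_eq_self]
  module

lemma isPreconditioner_fosiPreconditioner {p : Fin n → ℝ} {V : Matrix (Fin n) κ ℝ} {u : κ → ℝ}
    {a K : ℝ} (ha : 0 ≤ a) (hK : 0 ≤ K) (hV : Vᵀ * V * Vᵀ = Vᵀ) (hp : ∀ j, (p j)⁻¹ ∈ Set.Icc a K)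
    (hu : ∀ i, u i ∈ Set.Icc a K) :
    IsPreconditioner a K (fosiPreconditioner p V u) := by
  let J : Matrix (κ ⊕ Fin n) (Fin n) ℝ := fromRows Vᵀ (1 - V * Vᵀ)
  have hJt : Jᵀ = fromCols V (1 - V * Vᵀ) := by
    simp [J, transpose_fromRows]
  have hJ : Jᵀ * J = 1 := by
    have hVV : V * Vᵀ * (V * Vᵀ) = V * Vᵀ := by
      rw [Matrix.mul_assoc, ← Matrix.mul_assoc Vᵀ, hV]
    rw [hJt, fromCols_mul_fromRows, Matrix.sub_mul, Matrix.mul_sub, Matrix.mul_sub, hVV]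
    simp
  have hP : fosiPreconditioner p V u =
      toEuclideanCLM (𝕜 := ℝ) (Jᵀ * diagonal (Sum.elim u p⁻¹) * J) := by
    rw [fosiPreconditioner, hJt, ← fromBlocks_diagonal, fromCols_mul_fromBlocks,
      fromCols_mul_fromRows]
    simp
  rw [hP]
  exact isPreconditioner_toEuclideanCLM hJ ha hK (by rintro (i | j); exacts [hu i, hp j])

end FOSIPreconditioner

section ESE

open Matrix

variable {n m k l : ℕ} {A : Matrix (Fin n) (Fin n) ℝ}

lemma add_le_lanczosSteps (hkl : k + l ≤ n) : k + l ≤ lanczosSteps n k l :=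
  le_min hkl (le_max_of_le_left (by omega))

lemma injective_of_extreme_indices {r : Fin k ⊕ Fin l → Fin m} (hkl : k + l ≤ m)
    (hinl : ∀ i, (r (.inl i) : ℕ) = i) (hinr : ∀ j, (r (.inr j) : ℕ) + l = m + j) :
    Function.Injective r := by
  rintro (i | i) (j | j) hij <;> have hval := congrArg Fin.val hij
  · exact congrArg Sum.inl (Fin.ext (by rwa [hinl, hinl] at hval))
  · have := hinl i; have := hinr j; omega
  · have := hinr i; have := hinl j; omega
  · exact congrArg Sum.inr (Fin.ext (by have := hinr i; have := hinr j; omega))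

lemma IsLanczosOutput.compression_eq {U : Matrix (Fin n) (Fin m) ℝ}
    {T : Matrix (Fin m) (Fin m) ℝ} (h : IsLanczosOutput A U T) : Uᵀ * A * U = T := by
  have hresidual := h.residual
  rwa [Matrix.mul_sub, ← Matrix.mul_assoc, ← Matrix.mul_assoc, h.orthonormal, Matrix.one_mul,
    sub_eq_zero] at hresidual

lemma IsLanczosOutput.ritz_orthonormal {U : Matrix (Fin n) (Fin m) ℝ}
    {T Q : Matrix (Fin m) (Fin m) ℝ} (h : IsLanczosOutput A U T) (hQ : Qᵀ * Q = 1) :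
    (U * Q)ᵀ * (U * Q) = 1 := by
  rw [transpose_mul, Matrix.mul_assoc, ← Matrix.mul_assoc Uᵀ, h.orthonormal, Matrix.one_mul, hQ]

lemma IsLanczosOutput.ritz_compression_eq {U : Matrix (Fin n) (Fin m) ℝ}
    {Q : Matrix (Fin m) (Fin m) ℝ} {Λ : Fin m → ℝ}
    (h : IsLanczosOutput A U (Q * diagonal Λ * Qᵀ)) (hQ : Qᵀ * Q = 1) :
    (U * Q)ᵀ * A * (U * Q) = diagonal Λ :=
  calc (U * Q)ᵀ * A * (U * Q) = Qᵀ * (Uᵀ * A * U) * Q := by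
        simp only [transpose_mul, Matrix.mul_assoc]
    _ = (Qᵀ * Q) * diagonal Λ * (Qᵀ * Q) := by
        rw [h.compression_eq]; simp only [Matrix.mul_assoc]
    _ = diagonal Λ := by rw [hQ, Matrix.one_mul, Matrix.mul_one]

lemma IsESEOutput.orthonormal_and_compression_eq {lam : Fin k ⊕ Fin l → ℝ}
    {V : Matrix (Fin n) (Fin k ⊕ Fin l) ℝ} (hkl : k + l ≤ n) (h : IsESEOutput A lam V) :
    Vᵀ * V = 1 ∧ Vᵀ * A * V = diagonal lam := by
  obtain ⟨U, T, Q, Λ, hL, hQ, rfl, -, hlargest, hsmallest⟩ := h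
  choose r₁ hr₁ hlam₁ hV₁ using hlargest
  choose r₂ hr₂ hlam₂ hV₂ using hsmallest
  let r : Fin k ⊕ Fin l → Fin (lanczosSteps n k l) := Sum.elim r₁ r₂
  have hr : Function.Injective r := injective_of_extreme_indices (add_le_lanczosSteps hkl) hr₁ hr₂
  have hV : V = (U * Q).submatrix id r := by
    ext a (i | j)
    exacts [hV₁ i a, hV₂ j a]
  have hlam : lam = Λ ∘ r := by
    ext (i | j)
    exacts [hlam₁ i, hlam₂ j]
  constructor
  · calc Vᵀ * V = ((U * Q)ᵀ * (U * Q)).submatrix r r := by rw [hV]; rfl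
      _ = 1 := by rw [hL.ritz_orthonormal hQ, submatrix_one r hr]
  · calc Vᵀ * A * V = ((U * Q)ᵀ * A * (U * Q)).submatrix r r := by rw [hV]; rfl
      _ = diagonal lam := by
        rw [hL.ritz_compression_eq hQ, hlam, submatrix_diagonal _ _ hr]

lemma invAbs_mem_Icc {κ : Type} {δ z : ℝ} {lam : κ → ℝ} {i : κ} (hδ : 0 < δ)
    (hlam : |lam i| ≤ z) : invAbs δ lam i ∈ Set.Icc (1 / max z (2 * δ)) (1 / δ) := by
  unfold invAbs
  split_ifs with hi
  · have := abs_nonneg (lam i)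
    exact ⟨one_div_le_one_div_of_le (by positivity) (le_max_of_le_right (by linarith)),
      one_div_le_one_div_of_le hδ (by linarith)⟩
  · rw [not_lt] at hi
    exact ⟨one_div_le_one_div_of_le (by linarith) (le_max_of_le_left hlam),
      one_div_le_one_div_of_le hδ hi⟩

end ESE

section Hessian

open Matrix

variable {n : ℕ} {g : Vec n → ℝ} {θ : Vec n}

lemma toEuclideanCLM_hessianMatrix (g : Vec n → ℝ) (θ : Vec n) :
    toEuclideanCLM (𝕜 := ℝ) (hessianMatrix g θ) = hessian g θ := by
  refine ContinuousLinearMap.coe_injective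
    ((EuclideanSpace.basisFun (Fin n) ℝ).toBasis.ext fun j => ?_)
  ext i
  simp [hessianMatrix]

lemma inner_hessian_comm (hg : Differentiable ℝ g) (hg' : Differentiable ℝ (∇ g))
    (v w : Vec n) : inner ℝ (hessian g θ v) w = inner ℝ (hessian g θ w) v := by
  let J : Vec n →L[ℝ] Vec n →L[ℝ] ℝ := innerSL ℝ
  have hderiv : ∀ y, HasFDerivAt g (J (∇ g y)) y := fun y => (hg y).hasGradientAt.hasFDerivAt
  have hderiv₂ : HasFDerivAt (fun y => J (∇ g y)) (J ∘L hessian g θ) θ :=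
    J.hasFDerivAt.comp θ (hg' θ).hasFDerivAt
  exact second_derivative_symmetric hderiv hderiv₂ v w

lemma hessianMatrix_isSymm (hg : Differentiable ℝ g) (hg' : Differentiable ℝ (∇ g)) :
    (hessianMatrix g θ).IsSymm := by
  ext i j
  simpa [EuclideanSpace.inner_single_right, hessianMatrix] using
    inner_hessian_comm hg hg' (EuclideanSpace.single i 1) (EuclideanSpace.single j 1)

open scoped Matrix.Norms.L2Operator in
lemma abs_diag_compression_le {ι κ : Type*} [Fintype ι] [DecidableEq ι] [DecidableEq κ]
    {V : Matrix ι κ ℝ} (hV : Vᵀ * V = 1) (H : Matrix ι ι ℝ) (i : κ) :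
    |(Vᵀ * H * V) i i| ≤ ‖toEuclideanCLM (𝕜 := ℝ) H‖ := by
  set w : EuclideanSpace ℝ ι := WithLp.toLp 2 (Vᵀ i)
  have hw : ‖w‖ = 1 := by
    rw [← sq_eq_sq₀ (norm_nonneg w) zero_le_one, EuclideanSpace.real_norm_sq_eq]
    simpa [mul_apply, w, sq] using congrFun (congrFun hV i) i
  calc |(Vᵀ * H * V) i i| = |inner ℝ w (toEuclideanCLM (𝕜 := ℝ) H w)| := by
        rw [inner_toEuclideanCLM, dotProduct_mulVec]
        simp [w, mul_apply, dotProduct, vecMul]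
    _ ≤ ‖w‖ * ‖toEuclideanCLM (𝕜 := ℝ) H w‖ := abs_real_inner_le_norm _ _
    _ ≤ ‖toEuclideanCLM (𝕜 := ℝ) H‖ := by
        simpa [hw] using (toEuclideanCLM (𝕜 := ℝ) H).le_opNorm w

end Hessian

section MeasurableDerivative

variable {Y : Type*} [MeasurableSpace Y]

lemma measurable_euclideanSpace_iff {ι : Type*} {f : Y → EuclideanSpace ℝ ι} :
    Measurable f ↔ ∀ i, Measurable fun y => f y i :=
  ⟨fun hf i => (measurable_pi_apply i).comp ((WithLp.measurable_ofLp 2 _).comp hf),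
    fun hf => (WithLp.measurable_toLp 2 _).comp (measurable_pi_iff.2 hf)⟩

lemma measurable_mulVec_apply {ι κ : Type*} [Fintype κ] {M : Y → Matrix ι κ ℝ} {v : Y → κ → ℝ}
    (hM : ∀ i j, Measurable fun y => M y i j) (hv : ∀ j, Measurable fun y => v y j) (i : ι) :
    Measurable fun y => (M y).mulVec (v y) i := by
  simp only [Matrix.mulVec, dotProduct]
  fun_prop

-- Directional derivatives are limits of difference quotients with steps `1 / N`.
lemma measurable_fderiv_apply_of_measurable_uncurry {E G : Type*} [NormedAddCommGroup E]
    [NormedSpace ℝ E] [MeasurableSpace E] [BorelSpace E] [SecondCountableTopology E]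
    [NormedAddCommGroup G] [NormedSpace ℝ G] [MeasurableSpace G] [BorelSpace G]
    [SecondCountableTopology G] {h : E → Y → G} (hm : Measurable (Function.uncurry h))
    (hd : ∀ y, Differentiable ℝ fun x => h x y) (v : E) :
    Measurable fun q : E × Y => fderiv ℝ (fun x => h x q.2) q.1 v := by
  refine measurable_of_tendsto_metrizable (f := fun (N : ℕ) (q : E × Y) =>
    (N : ℝ) • (h (q.1 + (N : ℝ)⁻¹ • v) q.2 - h q.1 q.2)) (fun N => ?_) ?_
  · have hshift : Measurable fun q : E × Y => h (q.1 + (N : ℝ)⁻¹ • v) q.2 :=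
      hm.comp ((measurable_fst.add_const _).prodMk measurable_snd)
    exact (hshift.sub hm).const_smul (N : ℝ)
  · refine tendsto_pi_nhds.2 fun q => (hd q.2 q.1).hasFDerivAt.lim v ?_
    simpa using tendsto_natCast_atTop_atTop (R := ℝ)

lemma measurable_gradient_of_measurable_uncurry {ι : Type*} [Fintype ι]
    {h : EuclideanSpace ℝ ι → Y → ℝ} (hm : Measurable (Function.uncurry h))
    (hd : ∀ y, Differentiable ℝ fun x => h x y) :
    Measurable fun q : EuclideanSpace ℝ ι × Y => ∇ (fun x => h x q.2) q.1 := by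
  classical
  refine measurable_euclideanSpace_iff.2 fun i => ?_
  have hcoord : ∀ q : EuclideanSpace ℝ ι × Y, ∇ (fun x => h x q.2) q.1 i =
      fderiv ℝ (fun x => h x q.2) q.1 (EuclideanSpace.single i 1) := fun q => by
    simp [← inner_gradient_left, EuclideanSpace.inner_single_right]
  simp only [hcoord]
  exact measurable_fderiv_apply_of_measurable_uncurry hm hd _

lemma measurable_hessianMatrix_of_measurable_uncurry {n : ℕ} {h : Vec n → Y → ℝ}
    (hm : Measurable (Function.uncurry h)) (hd : ∀ y, Differentiable ℝ fun x => h x y)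
    (hd' : ∀ y, Differentiable ℝ (∇ fun x => h x y)) :
    Measurable fun q : Vec n × Y => fun i j => hessianMatrix (fun x => h x q.2) q.1 i j :=
  measurable_pi_iff.2 fun i => measurable_pi_iff.2 fun j =>
    measurable_euclideanSpace_iff.1 (measurable_fderiv_apply_of_measurable_uncurry
      (h := fun x y => ∇ (fun x => h x y) x) (measurable_gradient_of_measurable_uncurry hm hd) hd'
      (EuclideanSpace.single j 1)) i

end MeasurableDerivative

section LinearCombination

variable {ι : Type*} [Fintype ι]

lemma gradient_const_mul_sum {E : Type*} [NormedAddCommGroup E] [InnerProductSpace ℝ E]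
    [CompleteSpace E] {g : ι → E → ℝ} (hg : ∀ i, Differentiable ℝ (g i)) (a : ℝ) :
    ∇ (fun θ => a * ∑ i, g i θ) = fun θ => a • ∑ i, ∇ (g i) θ := by
  funext θ
  have hsum : HasFDerivAt (fun θ => a * ∑ i, g i θ) (a • ∑ i, fderiv ℝ (g i) θ) θ :=
    (HasFDerivAt.fun_sum fun i _ => (hg i θ).hasFDerivAt).const_mul _
  simp only [gradient, hsum.fderiv, map_smul, map_sum]

variable {n : ℕ} {g : ι → Vec n → ℝ} (hg : ∀ i, Differentiable ℝ (g i))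
  (hg' : ∀ i, Differentiable ℝ (∇ (g i)))
include hg hg'

lemma differentiable_gradient_const_mul_sum (a : ℝ) :
    Differentiable ℝ (∇ fun θ => a * ∑ i, g i θ) := by
  rw [gradient_const_mul_sum hg]
  fun_prop

lemma hessian_const_mul_sum (a : ℝ) (θ : Vec n) :
    hessian (fun θ => a * ∑ i, g i θ) θ = a • ∑ i, hessian (g i) θ := by
  rw [hessian, gradient_const_mul_sum hg]
  exact (HasFDerivAt.const_smul (HasFDerivAt.fun_sum fun i _ => (hg' i θ).hasFDerivAt) a).fderiv

end LinearCombination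

section MeasurableStep

variable {n : ℕ} {κ : Type} {Ω : Type*} [MeasurableSpace Ω]

lemma measurable_invAbs (δ : ℝ) {lam : Ω → κ → ℝ} {i : κ} (hlam : Measurable fun ω => lam ω i) :
    Measurable fun ω => invAbs δ (lam ω) i := by
  have habs : Measurable fun ω => |lam ω i| := by simpa only [← Real.norm_eq_abs] using hlam.norm
  exact (Measurable.ite (measurableSet_lt habs measurable_const) (habs.add_const δ) habs).const_div
    1

variable [Fintype κ] {p : Ω → Fin n → ℝ} {V : Ω → Matrix (Fin n) κ ℝ} {u : Ω → κ → ℝ}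
  {θ g : Ω → Vec n}

lemma measurable_colProj (hV : ∀ i j, Measurable fun ω => V ω i j) (hg : Measurable g) :
    Measurable fun ω => colProj (V ω) (g ω) :=
  measurable_euclideanSpace_iff.2 <| measurable_mulVec_apply hV <|
    measurable_mulVec_apply (fun i j => hV j i) (measurable_euclideanSpace_iff.1 hg)

lemma measurable_baseOptStep (η : ℝ) (hp : ∀ i, Measurable fun ω => p ω i) (hg : Measurable g) :
    Measurable fun ω => baseOptStep η (p ω) (g ω) :=
  measurable_euclideanSpace_iff.2 fun i =>
    ((hp i).inv.mul (measurable_euclideanSpace_iff.1 hg i)).const_mul _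

lemma measurable_updateStep (α η : ℝ) (hp : ∀ i, Measurable fun ω => p ω i) (hθ : Measurable θ)
    (hg : Measurable g) (hV : ∀ i j, Measurable fun ω => V ω i j)
    (hu : ∀ i, Measurable fun ω => u ω i) :
    Measurable fun ω => updateStep α η (p ω) (θ ω) (g ω) (V ω) (u ω) := by
  have hproj := measurable_colProj hV hg
  have hbase := measurable_baseOptStep η hp (hg.sub hproj)
  have hnewton : Measurable fun ω => (WithLp.toLp 2 ((V ω).mulVec fun i =>
      (V ω).transpose.mulVec (colProj (V ω) (g ω)).ofLp i * u ω i) : Vec n) :=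
    measurable_euclideanSpace_iff.2 <| measurable_mulVec_apply hV fun i =>
      (measurable_mulVec_apply (fun i j => hV j i) (measurable_euclideanSpace_iff.1 hproj) i).mul
        (hu i)
  exact (hθ.add (hnewton.const_smul α).neg).add (hbase.sub (measurable_colProj hV hbase))

end MeasurableStep

section BoundedSpectrum

open Matrix

variable {n : ℕ} {κ : Type} [DecidableEq κ] {a K K' : ℝ} {V : Matrix (Fin n) κ ℝ}
  {u : κ → ℝ}

/-- The invariant of the spectral data `V̂`, `u` of FOSI: either ESE has not been called yet and
`V̂ = 0`, or `V̂` has orthonormal columns and the inverse curvatures `u` lie in `[a, K]`. -/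
def IsBoundedSpectrum (a K : ℝ) (V : Matrix (Fin n) κ ℝ) (u : κ → ℝ) : Prop :=
  V = 0 ∨ (Vᵀ * V = 1 ∧ ∀ i, u i ∈ Set.Icc a K)

lemma IsBoundedSpectrum.mono (h : IsBoundedSpectrum a K V u) (hK : K ≤ K') :
    IsBoundedSpectrum a K' V u :=
  h.imp id <| And.imp id fun hu i => Set.Icc_subset_Icc_right hK (hu i)

variable [Fintype κ]

lemma IsBoundedSpectrum.transpose_mul_mul_transpose (h : IsBoundedSpectrum a K V u) :
    Vᵀ * V * Vᵀ = Vᵀ := by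
  obtain rfl | ⟨hV, -⟩ := h
  · simp
  · rw [hV, Matrix.one_mul]

lemma IsBoundedSpectrum.isPreconditioner (h : IsBoundedSpectrum a K V u) {p : Fin n → ℝ}
    (ha : 0 ≤ a) (haK : a ≤ K) (hp : ∀ j, (p j)⁻¹ ∈ Set.Icc a K) :
    IsPreconditioner a K (fosiPreconditioner p V u) := by
  have hV := h.transpose_mul_mul_transpose
  obtain rfl | ⟨-, hu⟩ := h
  · have hconst : fosiPreconditioner p (0 : Matrix (Fin n) κ ℝ) u =
        fosiPreconditioner p (0 : Matrix (Fin n) κ ℝ) fun _ => a := by simp [fosiPreconditioner]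
    rw [hconst]
    exact isPreconditioner_fosiPreconditioner ha (ha.trans haK) hV hp fun _ => ⟨le_rfl, haK⟩
  · exact isPreconditioner_fosiPreconditioner ha (ha.trans haK) hV hp hu

lemma IsBoundedSpectrum.fosiPreconditioner_apply (h : IsBoundedSpectrum a K V u) (p : Fin n → ℝ)
    (g : Vec n) : fosiPreconditioner p V u g = -updateStep 1 1 p 0 g V u := by
  rw [updateStep_eq_sub_smul_fosiPreconditioner h.transpose_mul_mul_transpose]
  simp

end BoundedSpectrum

namespace FOSI

variable {n d k l : ℕ} {A : FOSI n d k l}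

section BatchLoss

variable (hd : ∀ x, Differentiable ℝ fun θ => A.F θ x)
include hd

lemma differentiable_batchLoss (b : A.Batches) (t : ℕ) : Differentiable ℝ (A.batchLoss b t) := by
  unfold batchLoss
  fun_prop

lemma gradient_batchLoss (b : A.Batches) (t : ℕ) (θ : Vec n) :
    ∇ (A.batchLoss b t) θ = (1 / (A.batchSize t : ℝ)) • ∑ i, ∇ (fun θ' => A.F θ' (b t i)) θ :=
  congrFun (gradient_const_mul_sum (fun i => hd (b t i)) _) θ

variable (hd' : ∀ x, Differentiable ℝ (∇ fun θ => A.F θ x))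
include hd'

lemma differentiable_gradient_batchLoss (b : A.Batches) (t : ℕ) :
    Differentiable ℝ (∇ (A.batchLoss b t)) :=
  differentiable_gradient_const_mul_sum (fun i => hd (b t i)) (fun i => hd' (b t i)) _

lemma norm_hessian_batchLoss_le {z : ℝ} (hz : ∀ θ x, ‖hessian (fun θ' => A.F θ' x) θ‖ ≤ z)
    {t : ℕ} (ht : 1 ≤ A.batchSize t) (b : A.Batches) (θ : Vec n) :
    ‖hessian (A.batchLoss b t) θ‖ ≤ z := by
  have ht' : (0 : ℝ) < A.batchSize t := by exact_mod_cast ht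
  calc ‖hessian (A.batchLoss b t) θ‖
      = (A.batchSize t : ℝ)⁻¹ * ‖∑ i, hessian (fun θ' => A.F θ' (b t i)) θ‖ := by
        unfold batchLoss
        rw [hessian_const_mul_sum (fun i => hd (b t i)) (fun i => hd' (b t i)), norm_smul,
          Real.norm_of_nonneg (by positivity), one_div]
    _ ≤ (A.batchSize t : ℝ)⁻¹ * ∑ _i : Fin (A.batchSize t), z := by
        gcongr
        exact norm_sum_le_of_le _ fun i _ => hz θ (b t i)
    _ = z := by simp [ht'.ne']

end BatchLoss

section Measurability

/-- A random state of FOSI all of whose components are measurable. -/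
structure MeasurableState {Ω : Type*} [MeasurableSpace Ω] {t : ℕ}
    (s : Ω → FOSIState n k l t) : Prop where
  θ : Measurable fun ω => (s ω).θ
  u : ∀ i, Measurable fun ω => (s ω).u i
  V : ∀ i j, Measurable fun ω => (s ω).V i j
  hist : Measurable fun ω => (s ω).hist

variable {Ω : Type*} {m : MeasurableSpace Ω} {b : Ω → A.Batches} {t : ℕ} {θ : Ω → Vec n}
  {s : Ω → FOSIState n k l t}
  (hF : Measurable (Function.uncurry A.F)) (hd : ∀ x, Differentiable ℝ fun θ => A.F θ x)
  (hd' : ∀ x, Differentiable ℝ (∇ fun θ => A.F θ x))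

include hF

lemma measurable_uncurry_batchLoss (t : ℕ) : Measurable (Function.uncurry
    fun (θ : Vec n) (x : Fin (A.batchSize t) → Vec d) =>
      (1 / (A.batchSize t : ℝ)) * ∑ i, A.F θ (x i)) := by
  refine (Finset.measurable_sum _ fun i _ => ?_).const_mul _
  exact hF.comp (measurable_fst.prodMk ((measurable_pi_apply i).comp measurable_snd))

include hd

lemma measurable_gradient_batchLoss (hb : ∀ i, Measurable fun ω => b ω t i) (hθ : Measurable θ) :
    Measurable fun ω => ∇ (A.batchLoss (b ω) t) (θ ω) := by
  have hcomp := (measurable_gradient_of_measurable_uncurry (measurable_uncurry_batchLoss hF t)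
    fun y => (Differentiable.fun_sum fun i _ => hd (y i)).const_mul _).comp
    (hθ.prodMk (measurable_pi_iff.2 hb))
  simp only [Function.comp_def] at hcomp
  exact hcomp

include hd'

lemma measurable_hessianMatrix_batchLoss (hb : ∀ i, Measurable fun ω => b ω t i)
    (hθ : Measurable θ) :
    Measurable fun ω => fun i j => hessianMatrix (A.batchLoss (b ω) t) (θ ω) i j := by
  have hcomp := (measurable_hessianMatrix_of_measurable_uncurry (measurable_uncurry_batchLoss hF t)
    (fun y => (Differentiable.fun_sum fun i _ => hd (y i)).const_mul _) fun y =>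
      differentiable_gradient_const_mul_sum (fun i => hd (y i)) (fun i => hd' (y i)) _).comp
    (hθ.prodMk (measurable_pi_iff.2 hb))
  simp only [Function.comp_def] at hcomp
  exact hcomp

lemma measurableState_runESE (hese : A.IsESETime t → A.eseBatch t < t)
    (hb : ∀ s < t, ∀ i, Measurable fun ω => b ω s i) (hs : MeasurableState s) :
    MeasurableState fun ω => A.runESE (b ω) t (s ω) := by
  by_cases ht : A.IsESETime t
  · have hH := measurable_hessianMatrix_batchLoss hF hd hd' (hb _ (hese ht)) hs.θ
    simp only [runESE, if_pos ht]
    exact ⟨hs.θ,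
      fun i => measurable_invAbs _ (measurable_pi_iff.1 ((A.ese t).measurable_eigval.comp hH) i),
      fun i j => measurable_pi_iff.1
        (measurable_pi_iff.1 ((A.ese t).measurable_eigvec.comp hH) i) j, hs.hist⟩
  · simpa only [runESE, if_neg ht] using hs

lemma measurableState_step (hese : A.IsESETime t → A.eseBatch t < t)
    (hb : ∀ s < t + 1, ∀ i, Measurable fun ω => b ω s i) (hs : MeasurableState s) :
    MeasurableState fun ω => A.step (b ω) t (s ω) := by
  have hs' := measurableState_runESE hF hd hd' hese (fun r hr => hb r (by omega)) hs
  have hg := measurable_gradient_batchLoss hF hd (hb t (by omega)) hs'.θ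
  have hp := measurable_pi_iff.1 ((A.baseOpt.measurable_prec t).comp hs'.hist)
  refine ⟨measurable_updateStep _ _ hp hs'.θ hg hs'.V hs'.u, hs'.u, hs'.V,
    measurable_pi_iff.2 fun r => ?_⟩
  simp only [step]
  induction r using Fin.lastCases with
  | last => simpa only [Fin.snoc_last, Pi.sub_def] using hg.sub (measurable_colProj hs'.V hg)
  | cast r => simpa only [Fin.snoc_castSucc] using measurable_pi_iff.1 hs'.hist r

lemma measurableState_state (hese : ∀ t, A.IsESETime t → A.eseBatch t < t) (t : ℕ)
    (hb : ∀ s < t, ∀ i, Measurable fun ω => b ω s i) :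
    MeasurableState fun ω => A.state (b ω) t := by
  induction t with
  | zero =>
    exact ⟨measurable_const, fun _ => measurable_const, fun _ _ => measurable_const,
      measurable_const⟩
  | succ t ih =>
    exact measurableState_step hF hd hd' (hese t) hb (ih fun s hs => hb s (by omega))

lemma measurable_iterate (hese : ∀ t, A.IsESETime t → A.eseBatch t < t) (t : ℕ)
    (hb : ∀ s < t, ∀ i, Measurable fun ω => b ω s i) :
    Measurable fun ω => A.iterate (b ω) t :=
  (measurableState_state hF hd hd' hese t hb).θ

end Measurability

section Preconditioner

/-- The operator by which FOSI preconditions the stochastic gradient of iteration `t`. -/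
noncomputable def preconditioner (A : FOSI n d k l) (b : A.Batches) (t : ℕ) : Vec n →L[ℝ] Vec n :=
  fosiPreconditioner (A.precDiag b t) (A.runESE b t (A.state b t)).V (A.runESE b t (A.state b t)).u

lemma runESE_θ (b : A.Batches) (t : ℕ) (s : FOSIState n k l t) : (A.runESE b t s).θ = s.θ := by
  unfold runESE; split_ifs <;> rfl

lemma runESE_hist (b : A.Batches) (t : ℕ) (s : FOSIState n k l t) :
    (A.runESE b t s).hist = s.hist := by
  unfold runESE; split_ifs <;> rfl

variable {z : ℝ} (hdamp : 0 < A.damping) (hkl : k + l ≤ n) (hbatch : ∀ t, 1 ≤ A.batchSize t)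
  (hd : ∀ x, Differentiable ℝ fun θ => A.F θ x)
  (hd' : ∀ x, Differentiable ℝ (∇ fun θ => A.F θ x))
  (hz : ∀ θ x, ‖hessian (fun θ' => A.F θ' x) θ‖ ≤ z)
include hdamp hkl hbatch hd hd' hz

lemma isBoundedSpectrum_runESE (b : A.Batches) (t : ℕ) {s : FOSIState n k l t}
    (hs : IsBoundedSpectrum (1 / max z (2 * A.damping)) (1 / A.damping) s.V s.u) :
    IsBoundedSpectrum (1 / max z (2 * A.damping)) (1 / A.damping)
      (A.runESE b t s).V (A.runESE b t s).u := by
  unfold runESE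
  split_ifs
  · have hsymm := hessianMatrix_isSymm (θ := s.θ) (differentiable_batchLoss hd b (A.eseBatch t))
      (differentiable_gradient_batchLoss hd hd' b (A.eseBatch t))
    obtain ⟨hV, hlam⟩ := ((A.ese t).isOutput _ hsymm).orthonormal_and_compression_eq hkl
    refine .inr ⟨hV, fun i => invAbs_mem_Icc hdamp ?_⟩
    have hdiag := abs_diag_compression_le hV
      (hessianMatrix (A.batchLoss b (A.eseBatch t)) s.θ) i
    rw [hlam, Matrix.diagonal_apply_eq, toEuclideanCLM_hessianMatrix] at hdiag
    exact hdiag.trans (norm_hessian_batchLoss_le hd hd' hz (hbatch _) b s.θ)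
  · exact hs

lemma isBoundedSpectrum_state (b : A.Batches) (t : ℕ) :
    IsBoundedSpectrum (1 / max z (2 * A.damping)) (1 / A.damping)
      (A.state b t).V (A.state b t).u := by
  induction t with
  | zero => exact .inl rfl
  | succ t ih => exact isBoundedSpectrum_runESE hdamp hkl hbatch hd hd' hz b t ih

lemma isBoundedSpectrum_runESE_state (b : A.Batches) (t : ℕ) :
    IsBoundedSpectrum (1 / max z (2 * A.damping)) (1 / A.damping)
      (A.runESE b t (A.state b t)).V (A.runESE b t (A.state b t)).u :=
  isBoundedSpectrum_runESE hdamp hkl hbatch hd hd' hz b t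
    (isBoundedSpectrum_state hdamp hkl hbatch hd hd' hz b t)

lemma iterate_succ (b : A.Batches) (t : ℕ) :
    A.iterate b (t + 1) = A.iterate b t
      - A.stepSize t • A.preconditioner b t (∇ (A.batchLoss b t) (A.iterate b t)) := by
  have hV := (isBoundedSpectrum_runESE_state hdamp hkl hbatch hd hd' hz b
    t).transpose_mul_mul_transpose
  simp only [iterate, state, step, updateStep_eq_sub_smul_fosiPreconditioner hV, runESE_θ,
    runESE_hist, preconditioner, precDiag]

lemma isPreconditioner_preconditioner {ρ : ℝ} (hρ : 0 < ρ) {b : A.Batches} {t : ℕ}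
    (hp : ∀ j, ρ ≤ A.precDiag b t j ∧ A.precDiag b t j ≤ z) :
    IsPreconditioner (1 / max z (2 * A.damping)) (max (1 / A.damping) (1 / ρ))
      (A.preconditioner b t) := by
  have hspectrum := isBoundedSpectrum_runESE_state hdamp hkl hbatch hd hd' hz b t
  refine (hspectrum.mono (le_max_left _ (1 / ρ))).isPreconditioner (by positivity) ?_ fun j => ?_
  · exact le_max_of_le_left
      (one_div_le_one_div_of_le hdamp (le_max_of_le_right (by linarith)))
  · rw [← one_div]
    exact ⟨one_div_le_one_div_of_le (hρ.trans_le (hp j).1) (le_max_of_le_left (hp j).2),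
      le_max_of_le_right (one_div_le_one_div_of_le hρ (hp j).1)⟩

lemma measurable_preconditioner_apply {Ω : Type*} {m : MeasurableSpace Ω}
    (hF : Measurable (Function.uncurry A.F)) (hese : ∀ t, A.IsESETime t → A.eseBatch t < t)
    {b : Ω → A.Batches} {t : ℕ} (hb : ∀ s < t, ∀ i, Measurable fun ω => b ω s i) {g : Ω → Vec n}
    (hg : Measurable g) : Measurable fun ω => A.preconditioner (b ω) t (g ω) := by
  have hs := measurableState_state hF hd hd' hese t hb
  have hs' := measurableState_runESE hF hd hd' (hese t) hb hs
  have hp := measurable_pi_iff.1 ((A.baseOpt.measurable_prec t).comp hs.hist)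
  simp only [preconditioner, (isBoundedSpectrum_runESE_state hdamp hkl hbatch hd hd' hz _
    t).fosiPreconditioner_apply]
  exact (measurable_updateStep 1 1 hp measurable_const hg hs'.V hs'.u).neg

end Preconditioner

end FOSI

section SecondMoment

variable {Ω E : Type*} [MeasurableSpace Ω] {μ : Measure Ω} [NormedAddCommGroup E] {v : Ω → E}
  {σ : ℝ} (hv : AEStronglyMeasurable v μ)
  (hσ : ∫⁻ ω, ‖v ω‖ₑ ^ 2 ∂μ ≤ ENNReal.ofReal (σ ^ 2))
include hv hσ

lemma memLp_two_of_lintegral_enorm_sq_le : MemLp v 2 μ := by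
  refine ⟨hv, (eLpNorm_lt_top_iff_lintegral_rpow_enorm_lt_top (by norm_num) (by norm_num)).2 ?_⟩
  simpa using hσ.trans_lt ENNReal.ofReal_lt_top

lemma integral_norm_sq_le_of_lintegral_enorm_sq_le : ∫ ω, ‖v ω‖ ^ 2 ∂μ ≤ σ ^ 2 := by
  rw [integral_eq_lintegral_of_nonneg_ae (.of_forall fun _ => by positivity)
    (by simpa only [Pi.pow_def] using hv.norm.pow 2)]
  refine ENNReal.toReal_le_of_le_ofReal (sq_nonneg σ) ?_
  simpa only [ENNReal.ofReal_pow (norm_nonneg _), ofReal_norm] using hσ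

end SecondMoment

lemma norm_average_sq_le {E ι : Type*} [SeminormedAddCommGroup E] [NormedSpace ℝ E] [Fintype ι]
    [Nonempty ι] (v : ι → E) :
    ‖(1 / (Fintype.card ι : ℝ)) • ∑ i, v i‖ ^ 2 ≤
      (1 / (Fintype.card ι : ℝ)) * ∑ i, ‖v i‖ ^ 2 := by
  have : (0 : ℝ) < Fintype.card ι := by exact_mod_cast Fintype.card_pos
  calc ‖(1 / (Fintype.card ι : ℝ)) • ∑ i, v i‖ ^ 2
      = (1 / (Fintype.card ι : ℝ)) ^ 2 * ‖∑ i, v i‖ ^ 2 := by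
        rw [norm_smul, mul_pow, Real.norm_of_nonneg (by positivity)]
    _ ≤ (1 / (Fintype.card ι : ℝ)) ^ 2 * (∑ i, ‖v i‖) ^ 2 := by
        gcongr
        exact norm_sum_le _ _
    _ ≤ (1 / (Fintype.card ι : ℝ)) ^ 2 * (Fintype.card ι * ∑ i, ‖v i‖ ^ 2) := by
        gcongr
        exact sq_sum_le_card_mul_sum_sq
    _ = (1 / (Fintype.card ι : ℝ)) * ∑ i, ‖v i‖ ^ 2 := by field_simp

section Noise

variable {Ω T S E : Type*} {m mΩ : MeasurableSpace Ω} [MeasurableSpace T] [MeasurableSpace S]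
  {μ : Measure Ω}

section Independence

variable [IsFiniteMeasure μ] {Y : Ω → T} {x : Ω → S}

lemma lintegral_comp_prodMk_of_indepFun (hY : Measurable Y) (hx : Measurable x)
    (hind : IndepFun Y x μ) {g : T × S → ℝ≥0∞} (hg : Measurable g) :
    ∫⁻ ω, g (Y ω, x ω) ∂μ = ∫⁻ ω, ∫⁻ s, g (Y ω, s) ∂(μ.map x) ∂μ := by
  rw [← lintegral_map hg (hY.prodMk hx), hind.map_prod_eq_prod_map_map hY.aemeasurable
    hx.aemeasurable, lintegral_prod _ hg.aemeasurable, lintegral_map hg.lintegral_prod_right' hY]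

variable [NormedAddCommGroup E] [NormedSpace ℝ E] [CompleteSpace E] [StandardBorelSpace S]
  [Nonempty S] {ψ : T × S → E}

lemma condExp_comap_of_indepFun (hY : Measurable Y) (hx : Measurable x) (hind : IndepFun Y x μ)
    (hψ : StronglyMeasurable ψ) (hint : Integrable (fun ω => ψ (Y ω, x ω)) μ) :
    μ[fun ω => ψ (Y ω, x ω) | MeasurableSpace.comap Y inferInstance] =ᵐ[μ]
      fun ω => ∫ s, ψ (Y ω, s) ∂(μ.map x) := by
  have hdistrib : condDistrib x Y μ =ᵐ[μ.map Y] Kernel.const T (μ.map x) :=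
    condDistrib_ae_eq_of_measure_eq_compProd Y hx.aemeasurable <| by
      rw [Measure.compProd_const, hind.map_prod_eq_prod_map_map hY.aemeasurable hx.aemeasurable]
  filter_upwards [condExp_prod_ae_eq_integral_condDistrib hY hx.aemeasurable hψ hint,
    ae_of_ae_map hY.aemeasurable hdistrib] with ω hω hω_distrib
  rw [hω, hω_distrib, Kernel.const_apply]

-- This is `condExp_comap_of_indepFun` with `Y` the identity map from `mΩ` to the σ-algebra `m`.
lemma condExp_of_indep (hm : m ≤ mΩ) (hx : Measurable x)
    (hind : Indep m (MeasurableSpace.comap x inferInstance) μ) (hY : Measurable[m] Y)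
    (hψ : StronglyMeasurable ψ) (hint : Integrable (fun ω => ψ (Y ω, x ω)) μ) :
    μ[fun ω => ψ (Y ω, x ω) | m] =ᵐ[μ] fun ω => ∫ s, ψ (Y ω, s) ∂(μ.map x) := by
  have hψ_id : @StronglyMeasurable _ _ _ (m.prod _) fun q : Ω × S => ψ (Y q.1, q.2) :=
    hψ.comp_measurable (.prodMk (hY.comp (@measurable_fst Ω S m _)) (@measurable_snd Ω S m _))
  have hind_id : @IndepFun _ _ _ _ m _ id x μ := by
    rwa [@IndepFun_iff_Indep _ _ _ _ m, MeasurableSpace.comap_id]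
  have h := @condExp_comap_of_indepFun Ω Ω S E mΩ m _ μ _ id x _ _ _ _ _ _
    (measurable_id'' hm) hx hind_id hψ_id hint
  rwa [MeasurableSpace.comap_id] at h

end Independence

namespace IsCenteredNoise

variable {σ : ℝ} [NormedAddCommGroup E] [InnerProductSpace ℝ E] [CompleteSpace E]

lemma of_indep [IsProbabilityMeasure μ] [MeasurableSpace E] [BorelSpace E]
    [SecondCountableTopology E] [StandardBorelSpace S] [Nonempty S] (hm : m ≤ mΩ)
    {Y : Ω → T} {x : Ω → S} (hx : Measurable x)
    (hind : Indep m (MeasurableSpace.comap x inferInstance) μ) (hY : Measurable[m] Y)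
    {ψ : T × S → E} (hψ : Measurable ψ)
    (hzero : ∀ᵐ ω ∂μ, ∫ s, ψ (Y ω, s) ∂(μ.map x) = 0)
    (hσ : ∀ᵐ ω ∂μ, ∫⁻ s, ‖ψ (Y ω, s)‖ₑ ^ 2 ∂(μ.map x) ≤ ENNReal.ofReal (σ ^ 2)) :
    IsCenteredNoise m μ σ fun ω => ψ (Y ω, x ω) := by
  have hY' : Measurable Y := hY.mono hm le_rfl
  have hmeas := (hψ.comp (hY'.prodMk hx)).aestronglyMeasurable (μ := μ)
  have hindY : IndepFun Y x μ :=
    (IndepFun_iff_Indep _ _ _).2 (indep_of_indep_of_le_left hind hY.comap_le)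
  have hsq : ∫⁻ ω, ‖ψ (Y ω, x ω)‖ₑ ^ 2 ∂μ ≤ ENNReal.ofReal (σ ^ 2) := by
    rw [lintegral_comp_prodMk_of_indepFun hY' hx hindY (hψ.enorm.pow_const 2)]
    simpa using lintegral_mono_ae hσ
  have hL := memLp_two_of_lintegral_enorm_sq_le hmeas hsq
  exact ⟨hL, (condExp_of_indep hm hx hind hY hψ.stronglyMeasurable (hL.integrable one_le_two)).trans
    hzero, integral_norm_sq_le_of_lintegral_enorm_sq_le hmeas hsq⟩

lemma average {ι : Type*} [Fintype ι] [Nonempty ι] {ξ : ι → Ω → E} [IsFiniteMeasure μ]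
    (h : ∀ i, IsCenteredNoise m μ σ (ξ i)) :
    IsCenteredNoise m μ σ fun ω => (1 / (Fintype.card ι : ℝ)) • ∑ i, ξ i ω := by
  have hL : MemLp (fun ω => (1 / (Fintype.card ι : ℝ)) • ∑ i, ξ i ω) 2 μ :=
    (memLp_finsetSum Finset.univ fun i _ => (h i).memLp).const_smul (1 / (Fintype.card ι : ℝ))
  refine ⟨hL, ?_, ?_⟩
  · have hsum : μ[∑ i, ξ i | m] =ᵐ[μ] 0 := by
      refine (condExp_finsetSum (fun i _ => (h i).memLp.integrable one_le_two) m).trans ?_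
      filter_upwards [ae_all_iff.2 fun i => (h i).condExp_eq_zero] with ω hω
      simp [hω]
    have hsmul := condExp_smul (m := m) (μ := μ) (1 / (Fintype.card ι : ℝ)) (∑ i, ξ i)
    filter_upwards [hsmul, hsum] with ω hω hω_sum
    rw [Pi.smul_apply, hω_sum, Pi.zero_apply, smul_zero] at hω
    simpa only [Pi.smul_def, Finset.sum_apply, Pi.zero_apply] using hω
  · have hint : ∀ i, Integrable (fun ω => ‖ξ i ω‖ ^ 2) μ := fun i =>
      (h i).memLp.integrable_norm_pow two_ne_zero
    calc ∫ ω, ‖(1 / (Fintype.card ι : ℝ)) • ∑ i, ξ i ω‖ ^ 2 ∂μ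
        ≤ ∫ ω, (1 / (Fintype.card ι : ℝ)) * ∑ i, ‖ξ i ω‖ ^ 2 ∂μ :=
          integral_mono (hL.integrable_norm_pow two_ne_zero)
            ((integrable_finsetSum _ fun i _ => hint i).const_mul _) fun ω =>
              norm_average_sq_le fun i => ξ i ω
      _ = (1 / (Fintype.card ι : ℝ)) * ∑ i, ∫ ω, ‖ξ i ω‖ ^ 2 ∂μ := by
          rw [integral_const_mul, integral_finsetSum _ fun i _ => hint i]
      _ ≤ (1 / (Fintype.card ι : ℝ)) * ∑ _i : ι, σ ^ 2 := by
          gcongr with i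
          exact (h i).integral_norm_sq_le
      _ = σ ^ 2 := by simp

end IsCenteredNoise

end Noise

section BatchFiltration

variable {Ω S : Type*} {mΩ : MeasurableSpace Ω} [MeasurableSpace S] {ι : ℕ → Type*}
  {X : (t : ℕ) → ι t → Ω → S}

/-- The filtration generated by batches of samples `X t i`. Its σ-algebra at time `t` is generated
by the batches with index smaller than `t`, so that the batch `t` is not yet known. -/
def batchFiltration (hX : ∀ t i, Measurable (X t i)) : Filtration ℕ mΩ where
  seq t := ⨆ p ∈ {p : (t : ℕ) × ι t | p.1 < t}, MeasurableSpace.comap (X p.1 p.2) inferInstance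
  mono' _ _ hst := biSup_mono fun _ hp => lt_of_lt_of_le hp hst
  le' _ := iSup₂_le fun p _ => (hX p.1 p.2).comap_le

variable (hX : ∀ t i, Measurable (X t i))

lemma measurable_batchFiltration {s t : ℕ} (hst : s < t) (i : ι s) :
    Measurable[batchFiltration hX t] (X s i) :=
  .of_comap_le <| le_iSup₂_of_le (f := fun (p : (t : ℕ) × ι t) _ =>
    MeasurableSpace.comap (X p.1 p.2) inferInstance) ⟨s, i⟩ hst le_rfl

lemma indep_batchFiltration {μ : Measure Ω}
    (hind : iIndepFun (fun p : (t : ℕ) × ι t => X p.1 p.2) μ) (t : ℕ) (i : ι t) :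
    Indep (batchFiltration hX t) (MeasurableSpace.comap (X t i) inferInstance) μ := by
  have hdisj : Disjoint {p : (t : ℕ) × ι t | p.1 < t} {⟨t, i⟩} := by simp
  have hbatches := indep_iSup_of_disjoint
    (fun p : (t : ℕ) × ι t => (hX p.1 p.2).comap_le) hind hdisj
  refine indep_of_indep_of_le_right hbatches ?_
  simp

end BatchFiltration

lemma integral_sub_integral_eq_zero_of_lintegral_enorm_sq_le {S E : Type*} [MeasurableSpace S]
    {D : Measure S} [IsProbabilityMeasure D] [NormedAddCommGroup E] [NormedSpace ℝ E]
    [CompleteSpace E] {v : S → E} {e : E} {σ : ℝ} (hv : AEStronglyMeasurable v D)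
    (he : ∫ s, v s ∂D = e) (hσ : ∫⁻ s, ‖v s - e‖ₑ ^ 2 ∂D ≤ ENNReal.ofReal (σ ^ 2)) :
    ∫ s, v s - e ∂D = 0 := by
  have hdiff := (memLp_two_of_lintegral_enorm_sq_le (hv.sub aestronglyMeasurable_const)
    hσ).integrable one_le_two
  have hint : Integrable v D := by
    simpa only [Pi.add_def, sub_add_cancel] using hdiff.add (integrable_const e)
  simp [integral_sub hint (integrable_const e), he]

namespace FOSI

variable {n d k l : ℕ} {A : FOSI n d k l}

/-- The error of the mini-batch gradient of iteration `t` as an estimate of the gradient of the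
objective at the iterate. -/
noncomputable def gradientNoise (A : FOSI n d k l) (D : Measure (Vec d)) (b : A.Batches)
    (t : ℕ) : Vec n :=
  ∇ (A.batchLoss b t) (A.iterate b t) - ∇ (A.objective D) (A.iterate b t)

section Noise

variable {σ : ℝ} {D : Measure (Vec d)}
  (hbatch : ∀ t, 1 ≤ A.batchSize t) (hd : ∀ x, Differentiable ℝ fun θ => A.F θ x)
include hbatch hd

lemma gradientNoise_eq_average (b : A.Batches) (t : ℕ) :
    A.gradientNoise D b t = (1 / (Fintype.card (Fin (A.batchSize t)) : ℝ)) •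
      ∑ i, (∇ (fun θ' => A.F θ' (b t i)) (A.iterate b t) - ∇ (A.objective D) (A.iterate b t)) := by
  have ht : (A.batchSize t : ℝ) ≠ 0 := by
    have := hbatch t
    positivity
  rw [gradientNoise, gradient_batchLoss hd, Finset.sum_sub_distrib, smul_sub, Fintype.card_fin,
    Finset.sum_const, Finset.card_univ, Fintype.card_fin, ← Nat.cast_smul_eq_nsmul ℝ, smul_smul,
    one_div_mul_cancel ht, one_smul]

variable {Ω : Type*} {mΩ : MeasurableSpace Ω} {μ : Measure Ω} [IsProbabilityMeasure μ]
  [IsProbabilityMeasure D] {X : (t : ℕ) → Fin (A.batchSize t) → Ω → Vec d}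
  (hF : Measurable (Function.uncurry A.F)) (hd' : ∀ x, Differentiable ℝ (∇ fun θ => A.F θ x))
  (hese : ∀ t, A.IsESETime t → A.eseBatch t < t) (hX : ∀ t i, Measurable (X t i))
  (hf : Continuous (∇ (A.objective D)))
include hF hd' hese

omit hbatch in
lemma measurable_batchFiltration_iterate (t : ℕ) :
    Measurable[batchFiltration hX t] fun ω => A.iterate (fun s i => X s i ω) t :=
  measurable_iterate hF hd hd' hese t fun _ hs i => measurable_batchFiltration hX hs i

include hf

lemma isCenteredNoise_gradientNoise (hD : ∀ t i, μ.map (X t i) = D)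
    (hind : iIndepFun (fun p : (t : ℕ) × Fin (A.batchSize t) => X p.1 p.2) μ)
    {t : ℕ} (hnoise : ∀ᵐ ω ∂μ,
      let θ := A.iterate (fun s i => X s i ω) t
      ∫ x, ∇ (fun θ' => A.F θ' x) θ ∂D = ∇ (A.objective D) θ ∧
      ∫⁻ x, ‖∇ (fun θ' => A.F θ' x) θ - ∇ (A.objective D) θ‖ₑ ^ 2 ∂D ≤ ENNReal.ofReal (σ ^ 2)) :
    IsCenteredNoise (batchFiltration hX t) μ σ
      fun ω => A.gradientNoise D (fun s i => X s i ω) t := by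
  have : Nonempty (Fin (A.batchSize t)) := ⟨⟨0, hbatch t⟩⟩
  have hgrad := measurable_gradient_of_measurable_uncurry hF hd
  have hψ : Measurable fun q : Vec n × Vec d =>
      ∇ (fun θ' => A.F θ' q.2) q.1 - ∇ (A.objective D) q.1 :=
    hgrad.sub (hf.measurable.comp measurable_fst)
  simp only [gradientNoise_eq_average hbatch hd]
  refine IsCenteredNoise.average fun i => IsCenteredNoise.of_indep ((batchFiltration hX).le t)
    (hX t i) (indep_batchFiltration hX hind t i)
    (measurable_batchFiltration_iterate hd hF hd' hese hX t) hψ ?_ ?_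
  · filter_upwards [hnoise] with ω hω
    rw [hD]
    exact integral_sub_integral_eq_zero_of_lintegral_enorm_sq_le
      (hgrad.comp measurable_prodMk_left).aestronglyMeasurable hω.1 hω.2
  · filter_upwards [hnoise] with ω hω
    rw [hD]
    exact hω.2

lemma isPreconditionedSGD {z ρ : ℝ} (hdamp : 0 < A.damping) (hkl : k + l ≤ n)
    (hz : ∀ θ x, ‖hessian (fun θ' => A.F θ' x) θ‖ ≤ z) (hρ : 0 < ρ)
    (hp : ∀ t, ∀ᵐ ω ∂μ, ∀ j, ρ ≤ A.precDiag (fun s i => X s i ω) t j ∧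
      A.precDiag (fun s i => X s i ω) t j ≤ z)
    (hD : ∀ t i, μ.map (X t i) = D)
    (hind : iIndepFun (fun p : (t : ℕ) × Fin (A.batchSize t) => X p.1 p.2) μ)
    (hnoise : ∀ t, ∀ᵐ ω ∂μ,
      let θ := A.iterate (fun s i => X s i ω) t
      ∫ x, ∇ (fun θ' => A.F θ' x) θ ∂D = ∇ (A.objective D) θ ∧
      ∫⁻ x, ‖∇ (fun θ' => A.F θ' x) θ - ∇ (A.objective D) θ‖ₑ ^ 2 ∂D ≤ ENNReal.ofReal (σ ^ 2)) :
    IsPreconditionedSGD (A.objective D) (1 / max z (2 * A.damping))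
      (max (1 / A.damping) (1 / ρ)) σ A.stepSize (batchFiltration hX) μ
      (fun t ω => A.iterate (fun s i => X s i ω) t)
      (fun t ω => A.preconditioner (fun s i => X s i ω) t)
      (fun t ω => A.gradientNoise D (fun s i => X s i ω) t) where
  stronglyMeasurable_iterate t :=
    (measurable_batchFiltration_iterate hd hF hd' hese hX t).stronglyMeasurable
  stronglyMeasurable_direction t :=
    (measurable_preconditioner_apply hdamp hkl hbatch hd hd' hz hF hese
      (fun _ hs i => measurable_batchFiltration hX hs i)
      (hf.measurable.comp
        (measurable_batchFiltration_iterate hd hF hd' hese hX t))).stronglyMeasurable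
  isPreconditioner t := by
    filter_upwards [hp t] with ω hω
    exact isPreconditioner_preconditioner hdamp hkl hbatch hd hd' hz hρ hω
  isCenteredNoise t :=
    isCenteredNoise_gradientNoise hbatch hd hF hd' hese hX hf hD hind (hnoise t)
  integrable_init := integrable_const (A.objective D A.init)
  iterate_succ t ω := by
    rw [gradientNoise, add_sub_cancel]
    exact iterate_succ hdamp hkl hbatch hd hd' hz _ t

end Noise

end FOSI

/-- Iterations are numbered from `0`, so `A.iterate b t` is the iterate `θ_{t+1}` of the numbering
from `1`, and the step size `c (t + 1) ^ (-β)` of iteration `t` is `c t ^ (-β)` there. -/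
theorem lemma3 (L : ℝ≥0) (σ z δ ρ c β Δ : ℝ) (hσ : 0 < σ) (hz : 0 < z) (hδ : 0 < δ) (hρ : 0 < ρ)
    (hc : 0 < c) (hβ : β ∈ Set.Ioo (1 / 2 : ℝ) 1) :
    ∃ C : ℝ, 0 < C ∧
      ∀ (n d k l : ℕ) (A : FOSI n d k l) (D : Measure (Vec d)) [IsProbabilityMeasure D]
        (Ω : Type*) [MeasurableSpace Ω] (μ : Measure Ω) [IsProbabilityMeasure μ]
        (X : (t : ℕ) → Fin (A.batchSize t) → Ω → Vec d) (flow : ℝ),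
        -- the parameters of the algorithm
        k + l ≤ n → 1 ≤ A.T → (∀ t, 1 ≤ A.batchSize t) → A.damping = δ →
        (∀ t, A.stepSize t = c * ((t : ℝ) + 1) ^ (-β)) →
        (∀ t, A.IsESETime t → A.eseBatch t < t) →
        -- `F` is twice differentiable with respect to `θ`, and `f(θ) = E_x [F(θ, x)]` exists
        Measurable (Function.uncurry A.F) →
        (∀ x, Differentiable ℝ (fun θ => A.F θ x)) →
        (∀ x, Differentiable ℝ (gradient fun θ => A.F θ x)) →
        (∀ θ, Integrable (A.F θ) D) →
        -- the samples are independent with distribution `D`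
        (∀ t i, Measurable (X t i)) → (∀ t i, μ.map (X t i) = D) →
        iIndepFun (fun (p : (t : ℕ) × Fin (A.batchSize t)) => X p.1 p.2) μ →
        -- `f` is `L`-smooth and bounded below
        LSmooth L (A.objective D) → (∀ θ, flow ≤ A.objective D θ) →
        A.objective D A.init - flow ≤ Δ →
        -- the stochastic gradients are unbiased with variance at most `σ ^ 2`
        (∀ t, ∀ᵐ ω ∂μ,
          let θ := A.iterate (fun s i => X s i ω) t
          ∫ x, gradient (fun θ' => A.F θ' x) θ ∂D = gradient (A.objective D) θ ∧
          ∫⁻ x, ‖gradient (fun θ' => A.F θ' x) θ - gradient (A.objective D) θ‖ₑ ^ 2 ∂D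
            ≤ ENNReal.ofReal (σ ^ 2)) →
        -- bounded Hessians, and a bounded, uniformly positive definite preconditioner
        (∀ θ x, ‖hessian (fun θ' => A.F θ' x) θ‖ ≤ z) →
        (∀ t, ∀ᵐ ω ∂μ, ∀ j, ρ ≤ A.precDiag (fun s i => X s i ω) t j ∧
          A.precDiag (fun s i => X s i ω) t j ≤ z) →
        (∀ t, Integrable (fun ω =>
          ‖gradient (A.objective D) (A.iterate (fun s i => X s i ω) t)‖ ^ 2) μ) ∧
        ∀ ε ∈ Set.Ioo (0 : ℝ) 1, ∀ N : ℕ, C * ε ^ (-(1 / (1 - β))) ≤ N →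
          (1 / (N : ℝ)) * ∑ t ∈ Finset.range N,
            ∫ ω, ‖gradient (A.objective D) (A.iterate (fun s i => X s i ω) t)‖ ^ 2 ∂μ ≤ ε := by
  obtain ⟨C, hC, hrate⟩ := exists_forall_average_le (a := 1 / max z (2 * δ))
    (K := 2 * (L * max (1 / δ) (1 / ρ)) ^ 2) (B := L * max (1 / δ) (1 / ρ) ^ 2 * σ ^ 2)
    (by positivity) hc hβ (by positivity) (by positivity) Δ
  refine ⟨C, hC, ?_⟩
  intro n d k l A D _ Ω _ μ _ X flow hkl _ hbatch hdamp hη hese hF hd hd' _ hX hD hind hf hlow hΔ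
    hnoise hz hp
  have hη_nonneg : ∀ t, 0 ≤ A.stepSize t := fun t => by rw [hη]; positivity
  have hSGD := FOSI.isPreconditionedSGD hbatch hd hF hd' hese hX hf.2.continuous
    (hdamp ▸ hδ) hkl hz hρ hp hD hind hnoise
  rw [hdamp] at hSGD
  refine ⟨fun t => (hSGD.memLp_gradient_iterate hf.1 hf.2 hlow hη_nonneg
    t).integrable_norm_pow two_ne_zero, fun ε hε N hN => ?_⟩
  exact hrate A.stepSize
    (fun t => ∫ ω, A.objective D (A.iterate (fun s i => X s i ω) t) - flow ∂μ) _ hη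
    (fun t => integral_nonneg fun ω => sub_nonneg.2 (hlow _))
    (fun t => integral_nonneg fun ω => sq_nonneg _) (by simpa [FOSI.iterate, FOSI.state] using hΔ)
    (hSGD.integral_descent hf.1 hf.2 hlow hη_nonneg) ε hε.1 N hN
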